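/- Let $\mathcal M_d$ be the algebra of complex $d\times d$ matrices, $\mathcal S_d\subset\mathcal M_d$ the density matrices (positive semidefinite, trace $1$), $\|X\|_1=\mathrm{tr}\sqrt{X^\dagger X}$ and $d_{\mathrm{tr}}(\rho,\sigma)=\frac12\|\rho-\sigma\|_1$. A quantum channel is a completely positive trace-preserving linear map $T:\mathcal M_d\to\mathcal M_d$. Its asymptotic evolution is $T_\varphi=\sum_{|\mu|=1}\mu P_\mu$, where $\mu$ runs over the eigenvalues of $T$ of modulus $1$ and $P_\mu$ is the projection onto the generalized eigenspace of $T$ for $\mu$ along the other generalized eigenspaces. The trace-norm contraction of $T$ is $\eta_{\mathrm{tr}}[T]=\sup_{\rho\in\mathcal S_d}d_{\mathrm{tr}}(T(\rho),T_\varphi(\rho))$. A Liouvillian is a linear map $\mathcal L:\mathcal M_d\to\mathcal M_d$ such that $T_t=e^{t\mathcal L}$ is a quantum channel for every $t\ge0$. Its gap is $\bar\lambda=\inf\{|\mathrm{Re}\,\lambda| : \lambda\in\mathrm{spec}(\mathcal L),\ \mathrm{Re}\,\lambda<0\}$. A sequence $T^{(n)}_t$ of one-parameter semigroups of quantum channels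 exhibits a trace-norm pre-cutoff of order $\Theta(k_n)$ at times $t_{1,n},t_{2,n}$ if both times are $\Theta(k_n)$ as $n\to\infty$ and, for real $c>0$, $$c<1\ \Rightarrow\ \lim_{n\to\infty}\eta_{\mathrm{tr}}\big[T^{(n)}_{c\,t_{1,n}}\big]=1,\qquad c>1\ \Rightarrow\ \lim_{n\to\infty}\eta_{\mathrm{tr}}\big[T^{(n)}_{c\,t_{2,n}}\big]=0 .$$ **Theorem (Pre-cutoff for tensor powers).** (a) Let $\mathcal L:\mathcal M_d\to\mathcal M_d$ be a Liouvillian that has at least one eigenvalue with negative real part, let $\bar\lambda$ be its gap, and let $T_t=e^{t\mathcal L}$. Then the semigroups $T^{(n)}_t=T_t^{\otimes n}$ exhibit a trace-norm pre-cutoff of order $\Theta(\log n)$ at the times $t_{1,n}=\dfrac{\log n}{2\bar\lambda}$ and $t_{2,n}=\dfrac{\log n}{\bar\lambda}$. (b) For every quantum channel $T:\mathcal M_d\to\mathcal M_d$ and every identity channel $\mathrm{id}:\mathcal M_{d'}\to\mathcal M_{d'}$, $$\eta_{\mathrm{tr}}[T\otimes\mathrm{id}]\le 4d\,\eta_{\mathrm{tr}}[T].$$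 -/

import Mathlib

open Filter Topology Asymptotics
open scoped Matrix Kronecker ComplexOrder MatrixOrder

noncomputable section

namespace QuantumCutoff

/-- Linear maps `M_ι → M_ι` on complex matrices (superoperators); `M_d` is the case `ι = Fin d`. -/
abbrev SuperOp (ι : Type*) : Type _ := Module.End ℂ (Matrix ι ι ℂ)

section States

variable {ι : Type*} [Fintype ι] [DecidableEq ι]

/-- The density matrices. -/
def states (ι : Type*) [Fintype ι] : Set (Matrix ι ι ℂ) :=
  {ρ | ρ.PosSemidef ∧ ρ.trace = 1}

/-- The trace norm `tr √(X† X)`; `CFC.abs X` is `√(X† X)`. The trace is a nonnegative real. -/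
def traceNorm (X : Matrix ι ι ℂ) : ℝ := (CFC.abs X).trace.re

/-- The trace distance. -/
def traceDist (ρ σ : Matrix ι ι ℂ) : ℝ := traceNorm (ρ - σ) / 2

end States

section Tensor

variable {ι : Type*}

/-- `T ⊗ id` on `M_ι ⊗ M_κ = M_{ι × κ}`: the map `T` is applied to each `ι`-block. -/
def tensorId (T : SuperOp ι) (κ : Type*) : SuperOp (ι × κ) where
  toFun X := Matrix.of fun p q => T (Matrix.of fun a b => X (a, p.2) (b, q.2)) p.1 q.1
  map_add' X Y := by
    ext p q
    exact congrFun (congrFun (map_add T (Matrix.of fun a b => X (a, p.2) (b, q.2))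
      (Matrix.of fun a b => Y (a, p.2) (b, q.2))) p.1) q.1
  map_smul' z X := by
    ext p q
    exact congrFun (congrFun (map_smul T z (Matrix.of fun a b => X (a, p.2) (b, q.2))) p.1) q.1

theorem tensorId_kronecker (T : SuperOp ι) {κ : Type*} (A : Matrix ι ι ℂ) (B : Matrix κ κ ℂ) :
    tensorId T κ (A ⊗ₖ B) = T A ⊗ₖ B := by
  ext p q
  have h : (Matrix.of fun a b => (A ⊗ₖ B) (a, p.2) (b, q.2)) = B p.2 q.2 • A := by
    ext a b
    simp [Matrix.kroneckerMap_apply, mul_comm]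
  simp only [tensorId, LinearMap.coe_mk, AddHom.coe_mk, Matrix.of_apply, h, map_smul]
  simp [Matrix.kroneckerMap_apply, mul_comm]

variable [Fintype ι] [DecidableEq ι]

/-- The elementary tensor `X₁ ⊗ ⋯ ⊗ Xₙ` in `M_ι^{⊗n} = M_{ι^n}`. -/
def pureTensor {n : ℕ} (X : Fin n → Matrix ι ι ℂ) : Matrix (Fin n → ι) (Fin n → ι) ℂ :=
  Matrix.of fun a b => ∏ i, X i (a i) (b i)

/-- `T^{⊗n}` on `M_ι^{⊗n} = M_{ι^n}`: the linear map that sends each tensor product of matrix units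
`E_{c₁e₁} ⊗ ⋯ ⊗ E_{cₙeₙ}` to `T(E_{c₁e₁}) ⊗ ⋯ ⊗ T(E_{cₙeₙ})`. -/
def tensorPower (n : ℕ) (T : SuperOp ι) : SuperOp (Fin n → ι) where
  toFun X := ∑ c, ∑ e, X c e • pureTensor fun i => T (Matrix.single (c i) (e i) 1)
  map_add' X Y := by simp [add_smul, Finset.sum_add_distrib]
  map_smul' z X := by simp [mul_smul, Finset.smul_sum]

theorem tensorPower_pureTensor {n : ℕ} (T : SuperOp ι) (X : Fin n → Matrix ι ι ℂ) :
    tensorPower n T (pureTensor X) = pureTensor fun i => T (X i) := by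
  ext a b
  have h (i : Fin n) : T (X i) (a i) (b i)
      = ∑ p : ι × ι, X i p.1 p.2 * T (Matrix.single p.1 p.2 1) (a i) (b i) := by
    conv_lhs => rw [Matrix.matrix_eq_sum_single (X i)]
    simp only [map_sum, Matrix.sum_apply, Fintype.sum_prod_type]
    refine Finset.sum_congr rfl fun c _ => Finset.sum_congr rfl fun e _ => ?_
    have : Matrix.single c e (X i c e) = X i c e • Matrix.single c e (1 : ℂ) := by simp
    rw [this, map_smul]
    simp
  simp only [tensorPower, LinearMap.coe_mk, AddHom.coe_mk, pureTensor, Matrix.of_apply, h,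
    Matrix.sum_apply, Matrix.smul_apply, smul_eq_mul, ← Finset.prod_mul_distrib]
  rw [Finset.prod_univ_sum, Fintype.piFinset_univ, ← Fintype.sum_prod_type']
  exact (Fintype.sum_equiv (Equiv.arrowProdEquivProdArrow (Fin n) (fun _ => ι) (fun _ => ι))
    _ _ fun x => rfl).symm

end Tensor

section Channels

variable {ι : Type*} [Fintype ι] [DecidableEq ι]

/-- Complete positivity: `T ⊗ id` on `M_ι ⊗ M_k` preserves positive semidefiniteness for all `k`. -/
def IsCompletelyPositive (T : SuperOp ι) : Prop :=
  ∀ (k : ℕ) (X : Matrix (ι × Fin k) (ι × Fin k) ℂ),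
    X.PosSemidef → (tensorId T (Fin k) X).PosSemidef

/-- Quantum channels: completely positive trace-preserving maps. -/
structure IsChannel (T : SuperOp ι) : Prop where
  completelyPositive : IsCompletelyPositive T
  trace_map : ∀ X, (T X).trace = X.trace

/-- `e^{tL}`, computed in the matrix representation of `L` with respect to the matrix units. -/
def evolution (L : SuperOp ι) (t : ℝ) : SuperOp ι :=
  Matrix.toLin (Matrix.stdBasis ℂ ι ι) (Matrix.stdBasis ℂ ι ι)
    (NormedSpace.exp ((t : ℂ) •
      LinearMap.toMatrix (Matrix.stdBasis ℂ ι ι) (Matrix.stdBasis ℂ ι ι) L))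

/-- A Liouvillian generates a one-parameter semigroup of quantum channels. -/
def IsLiouvillian (L : SuperOp ι) : Prop :=
  ∀ t : ℝ, 0 ≤ t → IsChannel (evolution L t)

/-- A (continuous) one-parameter semigroup of quantum channels; only times `t ≥ 0` matter. -/
structure IsChannelSemigroup (T : ℝ → SuperOp ι) : Prop where
  channel : ∀ t, 0 ≤ t → IsChannel (T t)
  zero : T 0 = 1
  add : ∀ s t, 0 ≤ s → 0 ≤ t → T (s + t) = T s * T t
  continuousOn : ∀ X, ContinuousOn (fun t => T t X) (Set.Ici 0)

/-- The gap of a Liouvillian, `inf {|Re λ| : λ ∈ Σ(L), Re λ < 0}`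
(meaningful when this set is nonempty). -/
def gap (L : SuperOp ι) : ℝ :=
  sInf ((fun z : ℂ => |z.re|) '' {z | z ∈ spectrum ℂ L ∧ z.re < 0})

theorem isCompl_maxGenEigenspace (T : SuperOp ι) (μ : ℂ) :
    IsCompl (T.maxGenEigenspace μ) (⨆ ν, ⨆ (_ : ν ≠ μ), T.maxGenEigenspace ν) := by
  refine ⟨T.independent_maxGenEigenspace μ, codisjoint_iff.mpr (eq_top_iff.mpr ?_)⟩
  rw [← Module.End.iSup_maxGenEigenspace_eq_top T]
  refine iSup_le fun ν => ?_
  by_cases h : ν = μ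
  · exact h ▸ le_sup_left
  · exact le_sup_of_le_right (le_iSup₂_of_le ν h le_rfl)

/-- The projection onto the generalized eigenspace (the sum of the Jordan subspaces) of `T` for
`μ`, along the generalized eigenspaces for all other eigenvalues; it is `0` if `μ` is not an
eigenvalue. -/
def jordanProj (T : SuperOp ι) (μ : ℂ) : SuperOp ι :=
  Submodule.projection _ _ (isCompl_maxGenEigenspace T μ)

theorem finite_peripheral {ι : Type*} [Fintype ι] (T : SuperOp ι) : {μ : ℂ | T.HasEigenvalue μ ∧ ‖μ‖ = 1}.Finite :=
  (Module.End.finite_hasEigenvalue T).subset fun _ h => h.1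

/-- The asymptotic evolution `T_φ = ∑ μ • P_μ`, summed over the peripheral eigenvalues of `T`. -/
def asymptotic (T : SuperOp ι) : SuperOp ι :=
  ∑ μ ∈ (finite_peripheral T).toFinset, μ • jordanProj T μ

/-- The trace-norm contraction `sup_ρ d_tr(T ρ, T_φ ρ)` over density matrices `ρ`. -/
def contraction (T : SuperOp ι) : ℝ :=
  sSup ((fun ρ => traceDist (T ρ) (asymptotic T ρ)) '' states ι)

end Channels

/-- The sequence `T n` of one-parameter semigroups of channels exhibits a trace-norm pre-cutoff of
order `Θ(k n)` at times `t₁ n` and `t₂ n`. -/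
structure PreCutoff {ι : ℕ → Type*} [∀ n, Fintype (ι n)] [∀ n, DecidableEq (ι n)]
    (T : ∀ n, ℝ → SuperOp (ι n)) (k t₁ t₂ : ℕ → ℝ) : Prop where
  semigroup : ∀ n, IsChannelSemigroup (T n)
  order₁ : t₁ =Θ[atTop] k
  order₂ : t₂ =Θ[atTop] k
  before : ∀ c : ℝ, 0 < c → c < 1 →
    Tendsto (fun n => contraction (T n (c * t₁ n))) atTop (𝓝 1)
  after : ∀ c : ℝ, 1 < c →
    Tendsto (fun n => contraction (T n (c * t₂ n))) atTop (𝓝 0)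

end QuantumCutoff

end

set_option linter.unusedSectionVars false

noncomputable section

namespace QuantumCutoff

/-! ### Trace norm of Hermitian matrices through differences of positive semidefinite ones. -/

section TraceNorm

variable {ι κ : Type*} [Fintype ι] [DecidableEq ι] [Fintype κ] [DecidableEq κ]

/-! Write Δ = T - T_φ. For (b), expand (Δ ⊗ id)(M) = ∑ Δ(E_ij) ⊗ M_ij for a positive semidefinite M
and regroup into Hermitian pairs, whose norms are controlled by the diagonal blocks of M. This costs
a factor 2d, whatever the size of the second tensor factor (`traceNorm_tensorId_le`).

Both parts need T_φ to be compatible with tensor products. A channel has bounded powers, hence no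
peripheral Jordan blocks, so T_φ = T P with P the peripheral projection. Recurrence on a torus makes
P a limit of powers of T, and by `PowerBounded.peripheralProj_eq` it is the only idempotent limit
along exponents tending to infinity. Such limits pass to tensor products.

After the cutoff, replace the n factors T_t of the tensor power by their asymptotic versions one at
a time. By the bound behind (b) each replacement costs O(e^{-gt}) for any rate 0 ≤ g below the gap,
and n e^{-gt} → 0 at t = c log n / gap when c > 1 and g is close to the gap
(`traceNorm_tensorPower_sub_le`).

Before the cutoff, take a left eigenvector f of L whose eigenvalue has real part -gap. It vanishes
on asymptotic states, while |f(T_t ρ)| = e^{-gap t} |f ρ|. With input ρ^{⊗n}, measuring the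
observable of f on each factor yields n independent samples of mean m = e^{-gap t} |f ρ| in one case
and 0 in the other, with bounded variance. Chebyshev's inequality separates the two once n m² → ∞,
that is, for c < 1 (`le_traceDist_pureTensor`). The factor 2 between the two times is the gap
between the scales 1/n and 1/√n. -/

theorem traceNorm_eq_sum_abs_eigenvalues {X : Matrix ι ι ℂ} (hX : X.IsHermitian) :
    traceNorm X = ∑ i, |hX.eigenvalues i| := by
  have hX' : IsSelfAdjoint X := hX
  rw [traceNorm, CFC.abs_eq_cfc_norm X, hX.cfc_eq, Matrix.IsHermitian.cfc,
    Unitary.conjStarAlgAut_apply, Matrix.trace_mul_comm, ← mul_assoc]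
  simp [Matrix.trace, Matrix.diagonal]

/-- The diagonal entries of the conjugate of a Hermitian matrix by its eigenvector unitary. -/
theorem eigenvectorUnitary_conj {X : Matrix ι ι ℂ} (hX : X.IsHermitian) :
    (hX.eigenvectorUnitary : Matrix ι ι ℂ)ᴴ * X * (hX.eigenvectorUnitary : Matrix ι ι ℂ)
      = Matrix.diagonal (fun i => (hX.eigenvalues i : ℂ)) := by
  have h := hX.conjStarAlgAut_star_eigenvectorUnitary
  rw [Unitary.conjStarAlgAut_apply] at h
  simpa [Matrix.star_eq_conjTranspose, Function.comp_def] using h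

theorem PosSemidef.re_diag_nonneg {A : Matrix ι ι ℂ} (hA : A.PosSemidef) (i : ι) :
    0 ≤ (A i i).re := (Complex.le_def.mp hA.diag_nonneg).1

theorem PosSemidef.re_trace_nonneg {A : Matrix ι ι ℂ} (hA : A.PosSemidef) :
    0 ≤ A.trace.re := (Complex.le_def.mp hA.trace_nonneg).1

theorem PosSemidef.trace_eq_re {A : Matrix ι ι ℂ} (hA : A.PosSemidef) :
    A.trace = (A.trace.re : ℂ) := by
  apply Complex.ext
  · simp
  · simpa using (Complex.le_def.mp hA.trace_nonneg).2.symm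

theorem trace_unitary_conj {U : Matrix ι ι ℂ} (hU : U * Uᴴ = 1) (A : Matrix ι ι ℂ) :
    (Uᴴ * A * U).trace = A.trace := by
  rw [Matrix.trace_mul_comm, ← mul_assoc, hU, one_mul]

/-- In an eigenbasis of A - B each eigenvalue is a difference of nonnegative diagonal entries of A
and B. With `exists_posSemidef_sub` this makes the trace norm the minimum of tr A + tr B over such
decompositions. The triangle inequality, contraction under channels and the Kronecker bound all
follow from these two facts. -/
theorem traceNorm_sub_le {A B : Matrix ι ι ℂ} (hA : A.PosSemidef) (hB : B.PosSemidef) :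
    traceNorm (A - B) ≤ A.trace.re + B.trace.re := by
  have hX : (A - B).IsHermitian := hA.isHermitian.sub hB.isHermitian
  rw [traceNorm_eq_sum_abs_eigenvalues hX]
  set U : Matrix ι ι ℂ := (hX.eigenvectorUnitary).1
  have hU : U * Uᴴ = 1 := Unitary.coe_mul_star_self _
  have hD := eigenvectorUnitary_conj hX
  change Uᴴ * (A - B) * U = _ at hD
  rw [← trace_unitary_conj hU A, ← trace_unitary_conj hU B]
  simp only [Matrix.trace, Complex.re_sum, Matrix.diag_apply]
  rw [← Finset.sum_add_distrib]
  refine Finset.sum_le_sum fun i _ => ?_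
  have hi := congrArg Complex.re (congrFun (congrFun hD i) i)
  rw [mul_sub, sub_mul] at hi
  simp only [Matrix.sub_apply, Complex.sub_re, Matrix.diagonal_apply_eq, Complex.ofReal_re] at hi
  rw [← hi]
  have h1 := PosSemidef.re_diag_nonneg (hA.conjTranspose_mul_mul_same U) i
  have h2 := PosSemidef.re_diag_nonneg (hB.conjTranspose_mul_mul_same U) i
  exact abs_le.mpr ⟨by linarith, by linarith⟩

theorem traceNorm_nonneg {X : Matrix ι ι ℂ} : 0 ≤ traceNorm X := by
  have h : (CFC.abs X).PosSemidef := Matrix.nonneg_iff_posSemidef.mp (CFC.abs_nonneg X)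
  exact PosSemidef.re_trace_nonneg h

/-- The Jordan decomposition attains the trace norm. -/
theorem exists_posSemidef_sub {X : Matrix ι ι ℂ} (hX : X.IsHermitian) :
    ∃ A B : Matrix ι ι ℂ, A.PosSemidef ∧ B.PosSemidef ∧ X = A - B ∧
      A.trace.re + B.trace.re = traceNorm X := by
  have hX' : IsSelfAdjoint X := hX
  refine ⟨X⁺, X⁻, Matrix.nonneg_iff_posSemidef.mp (CFC.posPart_nonneg X),
    Matrix.nonneg_iff_posSemidef.mp (CFC.negPart_nonneg X), (CFC.posPart_sub_negPart X).symm, ?_⟩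
  rw [traceNorm, ← CFC.posPart_add_negPart X, Matrix.trace_add, Complex.add_re]

theorem traceNorm_add_le {X Y : Matrix ι ι ℂ} (hX : X.IsHermitian) (hY : Y.IsHermitian) :
    traceNorm (X + Y) ≤ traceNorm X + traceNorm Y := by
  obtain ⟨A, B, hA, hB, rfl, hs⟩ := exists_posSemidef_sub hX
  obtain ⟨C, D, hC, hD, rfl, ht⟩ := exists_posSemidef_sub hY
  have h := traceNorm_sub_le (hA.add hC) (hB.add hD)
  simp only [Matrix.trace_add, Complex.add_re] at h
  rw [show A - B + (C - D) = A + C - (B + D) by abel]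
  linarith

theorem traceNorm_neg_le {X : Matrix ι ι ℂ} (hX : X.IsHermitian) :
    traceNorm (-X) ≤ traceNorm X := by
  obtain ⟨A, B, hA, hB, rfl, hs⟩ := exists_posSemidef_sub hX
  rw [neg_sub, ← hs, add_comm]
  exact traceNorm_sub_le hB hA

theorem traceNorm_sub_le_add {X Y : Matrix ι ι ℂ} (hX : X.IsHermitian) (hY : Y.IsHermitian) :
    traceNorm (X - Y) ≤ traceNorm X + traceNorm Y := by
  rw [sub_eq_add_neg]
  exact (traceNorm_add_le hX hY.neg).trans (by gcongr; exact traceNorm_neg_le hY)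

theorem traceNorm_zero : traceNorm (0 : Matrix ι ι ℂ) = 0 := by
  simp [traceNorm]

theorem isHermitian_sum {α : Type*} (s : Finset α) {X : α → Matrix ι ι ℂ}
    (hX : ∀ i ∈ s, (X i).IsHermitian) : (∑ i ∈ s, X i).IsHermitian := by
  rw [Matrix.IsHermitian, Matrix.conjTranspose_sum]
  exact Finset.sum_congr rfl hX

theorem traceNorm_sum_le {α : Type*} (s : Finset α) {X : α → Matrix ι ι ℂ}
    (hX : ∀ i ∈ s, (X i).IsHermitian) : traceNorm (∑ i ∈ s, X i) ≤ ∑ i ∈ s, traceNorm (X i) := by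
  classical
  induction s using Finset.induction_on with
  | empty => simp [traceNorm_zero]
  | insert a s ha ih =>
    rw [Finset.sum_insert ha, Finset.sum_insert ha]
    refine (traceNorm_add_le (hX a (by simp))
      (isHermitian_sum s fun i hi => hX i (by simp [hi]))).trans ?_
    gcongr
    exact ih fun i hi => hX i (by simp [hi])

/-- A map that sends positive semidefinite matrices to positive semidefinite ones and does not
increase their trace contracts the trace norm. -/
theorem traceNorm_map_le (T : Matrix ι ι ℂ →ₗ[ℂ] Matrix κ κ ℂ)
    (hpos : ∀ A, A.PosSemidef → (T A).PosSemidef)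
    (htr : ∀ A, (T A).trace = A.trace) {X : Matrix ι ι ℂ} (hX : X.IsHermitian) :
    traceNorm (T X) ≤ traceNorm X := by
  obtain ⟨A, B, hA, hB, rfl, hs⟩ := exists_posSemidef_sub hX
  rw [map_sub, ← hs, ← htr A, ← htr B]
  exact traceNorm_sub_le (hpos A hA) (hpos B hB)

theorem traceNorm_kronecker_le {X : Matrix ι ι ℂ} {Y : Matrix κ κ ℂ} (hX : X.IsHermitian)
    (hY : Y.IsHermitian) : traceNorm (X ⊗ₖ Y) ≤ traceNorm X * traceNorm Y := by
  obtain ⟨A, B, hA, hB, rfl, hs⟩ := exists_posSemidef_sub hX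
  obtain ⟨C, D, hC, hD, rfl, ht⟩ := exists_posSemidef_sub hY
  have h := traceNorm_sub_le ((hA.kronecker hC).add (hB.kronecker hD))
    ((hA.kronecker hD).add (hB.kronecker hC))
  have e : (A - B) ⊗ₖ (C - D) = A ⊗ₖ C + B ⊗ₖ D - (A ⊗ₖ D + B ⊗ₖ C) := by
    ext p q
    simp only [Matrix.kroneckerMap_apply, Matrix.sub_apply, Matrix.add_apply]
    ring
  rw [e, ← hs, ← ht]
  refine h.trans (le_of_eq ?_)
  simp only [Matrix.trace_add, Matrix.trace_kronecker]
  rw [PosSemidef.trace_eq_re hA, PosSemidef.trace_eq_re hB, PosSemidef.trace_eq_re hC,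
    PosSemidef.trace_eq_re hD]
  simp only [← Complex.ofReal_mul, Complex.add_re, Complex.ofReal_re]
  ring

/-- The trace norm is invariant under relabelling the basis. -/
theorem traceNorm_submatrix_le (e : κ ≃ ι) {X : Matrix ι ι ℂ} (hX : X.IsHermitian) :
    traceNorm (X.submatrix e e) ≤ traceNorm X := by
  refine traceNorm_map_le (Matrix.reindexLinearEquiv ℂ ℂ e.symm e.symm).toLinearMap
    (fun A hA => hA.submatrix e) (fun A => ?_) hX
  simp only [LinearEquiv.coe_coe, Matrix.coe_reindexLinearEquiv, Matrix.reindex_apply,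
    Matrix.trace, Matrix.diag_apply, Matrix.submatrix_apply, Equiv.symm_symm]
  exact Fintype.sum_equiv e _ _ fun x => rfl

theorem norm_unitary_conj_diag_le {U : Matrix ι ι ℂ} (hU : U ∈ Matrix.unitaryGroup ι ℂ)
    (X : Matrix ι ι ℂ) (i : ι) : ‖(Uᴴ * X * U) i i‖ ≤ ∑ j, ∑ k, ‖X j k‖ := by
  have h1 (a b : ι) : ‖U a b‖ ≤ 1 := entry_norm_bound_of_unitary hU a b
  simp only [Matrix.mul_apply, Finset.sum_mul, Matrix.conjTranspose_apply]
  rw [Finset.sum_comm]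
  refine (norm_sum_le _ _).trans (Finset.sum_le_sum fun j _ => (norm_sum_le _ _).trans
    (Finset.sum_le_sum fun k _ => ?_))
  rw [norm_mul, norm_mul, norm_star]
  calc ‖U j i‖ * ‖X j k‖ * ‖U k i‖ ≤ 1 * ‖X j k‖ * 1 := by gcongr <;> exact h1 _ _
    _ = _ := by ring

theorem abs_eigenvalues_le {X : Matrix ι ι ℂ} (hX : X.IsHermitian) (i : ι) :
    |hX.eigenvalues i| ≤ ∑ j, ∑ k, ‖X j k‖ := by
  have h := norm_unitary_conj_diag_le hX.eigenvectorUnitary.2 X i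
  rw [eigenvectorUnitary_conj] at h
  simpa using h

/-- A crude dimension-dependent bound suffices: it is applied to a single tensor factor, whose
dimension does not grow with n. -/
theorem traceNorm_le_sum_norm {X : Matrix ι ι ℂ} (hX : X.IsHermitian) :
    traceNorm X ≤ Fintype.card ι * ∑ j, ∑ k, ‖X j k‖ := by
  rw [traceNorm_eq_sum_abs_eigenvalues hX]
  refine (Finset.sum_le_sum fun i _ => abs_eigenvalues_le hX i).trans (le_of_eq ?_)
  simp

/-- Measuring in an orthonormal basis and summing the outcomes with signs bounds the trace norm
from below. -/
theorem sum_sign_diag_le_traceNorm {W X : Matrix ι ι ℂ} (hW : W * Wᴴ = 1) (hX : X.IsHermitian)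
    (s : ι → ℝ) (hs : ∀ x, |s x| ≤ 1) :
    ∑ x, s x * ((Wᴴ * X * W) x x).re ≤ traceNorm X := by
  obtain ⟨A, B, hA, hB, rfl, hn⟩ := exists_posSemidef_sub hX
  rw [← hn, ← trace_unitary_conj hW A, ← trace_unitary_conj hW B]
  simp only [Matrix.trace, Complex.re_sum, Matrix.diag_apply]
  rw [← Finset.sum_add_distrib, mul_sub, sub_mul]
  refine Finset.sum_le_sum fun i _ => ?_
  have h1 := PosSemidef.re_diag_nonneg (hA.conjTranspose_mul_mul_same W) i
  have h2 := PosSemidef.re_diag_nonneg (hB.conjTranspose_mul_mul_same W) i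
  simp only [Matrix.sub_apply, Complex.sub_re]
  have := abs_le.mp (hs i)
  nlinarith

/-- With A = Bᴴ B, the arithmetic-geometric mean inequality bounds |A_ij| by (A_ii + A_jj) / 2. -/
theorem norm_apply_le_trace {A : Matrix ι ι ℂ} (hA : A.PosSemidef) (i j : ι) :
    ‖A i j‖ ≤ A.trace.re := by
  classical
  obtain ⟨B, rfl⟩ := CStarAlgebra.nonneg_iff_eq_star_mul_self.mp hA.nonneg
  rw [Matrix.star_eq_conjTranspose] at hA ⊢
  have key (k : ι) : ‖(Bᴴ) i k * B k j‖ ≤ (‖B k i‖ ^ 2 + ‖B k j‖ ^ 2) / 2 := by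
    rw [norm_mul, Matrix.conjTranspose_apply, norm_star]
    nlinarith [sq_nonneg (‖B k i‖ - ‖B k j‖)]
  have hd (a : ι) : ((Bᴴ * B) a a).re = ∑ k, ‖B k a‖ ^ 2 := by
    simp only [Matrix.mul_apply, Complex.re_sum, Matrix.conjTranspose_apply]
    refine Finset.sum_congr rfl fun k _ => ?_
    rw [Complex.star_def, ← Complex.normSq_eq_conj_mul_self, Complex.ofReal_re,
      Complex.normSq_eq_norm_sq]
  have ht (a : ι) : ((Bᴴ * B) a a).re ≤ (Bᴴ * B).trace.re := by
    simp only [Matrix.trace, Complex.re_sum, Matrix.diag_apply]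
    exact Finset.single_le_sum (f := fun a => ((Bᴴ * B) a a).re)
      (fun a _ => PosSemidef.re_diag_nonneg hA a) (Finset.mem_univ a)
  calc ‖(Bᴴ * B) i j‖ ≤ ∑ k, (‖B k i‖ ^ 2 + ‖B k j‖ ^ 2) / 2 := by
        rw [Matrix.mul_apply]
        exact (norm_sum_le _ _).trans (Finset.sum_le_sum fun k _ => key k)
    _ = (((Bᴴ * B) i i).re + ((Bᴴ * B) j j).re) / 2 := by
        rw [hd, hd, ← Finset.sum_add_distrib, Finset.sum_div]
    _ ≤ _ := by linarith [ht i, ht j]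

/-- Every matrix is a complex combination of four positive semidefinite ones. -/
theorem exists_posSemidef_combination (X : Matrix ι ι ℂ) :
    ∃ A B C D : Matrix ι ι ℂ, A.PosSemidef ∧ B.PosSemidef ∧ C.PosSemidef ∧ D.PosSemidef ∧
      X = (A - B) + Complex.I • (C - D) := by
  -- X = (X + Xᴴ)/2 + i · (i (Xᴴ - X))/2, and both terms in parentheses are Hermitian.
  have h1 : (X + Xᴴ).IsHermitian := Matrix.isHermitian_add_transpose_self X
  have h2 : (Complex.I • (Xᴴ - X)).IsHermitian := by
    rw [Matrix.IsHermitian, Matrix.conjTranspose_smul, Matrix.conjTranspose_sub,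
      Matrix.conjTranspose_conjTranspose, Complex.star_def, Complex.conj_I, neg_smul, ← smul_neg,
      neg_sub]
  obtain ⟨A, B, hA, hB, h, -⟩ := exists_posSemidef_sub h1
  obtain ⟨C, D, hC, hD, h', -⟩ := exists_posSemidef_sub h2
  have hp : (0 : ℂ) ≤ 1 / 2 := by norm_num [Complex.le_def]
  refine ⟨(1 / 2 : ℂ) • A, (1 / 2 : ℂ) • B, (1 / 2 : ℂ) • C, (1 / 2 : ℂ) • D,
    hA.smul hp, hB.smul hp, hC.smul hp, hD.smul hp, ?_⟩
  rw [← smul_sub, ← smul_sub, ← h, ← h']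
  ext i j
  simp only [Matrix.add_apply, Matrix.smul_apply, Matrix.sub_apply, smul_eq_mul]
  linear_combination (-1 / 2 * (Xᴴ i j - X i j)) * Complex.I_sq

/-- Positive semidefiniteness passes to entrywise limits. -/
theorem posSemidef_of_tendsto {α : Type*} {F : Filter α} [F.NeBot] {X : α → Matrix ι ι ℂ}
    {Y : Matrix ι ι ℂ} (hX : ∀ a, (X a).PosSemidef) (h : Tendsto X F (𝓝 Y)) : Y.PosSemidef := by
  rw [Matrix.posSemidef_iff_dotProduct_mulVec]
  constructor
  · have h2 : Tendsto (fun a => (X a)ᴴ) F (𝓝 Yᴴ) :=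
      (Continuous.matrix_conjTranspose continuous_id).continuousAt.tendsto.comp h
    exact tendsto_nhds_unique (h2.congr fun a => (hX a).isHermitian) h
  · intro x
    have hc : Continuous fun M : Matrix ι ι ℂ => star x ⬝ᵥ (M *ᵥ x) := by fun_prop
    exact ge_of_tendsto' ((hc.tendsto Y).comp h) fun a => (hX a).dotProduct_mulVec_nonneg x

end TraceNorm

/-! ### Kraus decompositions and closure properties of channels. -/

section Kraus

variable {ι κ : Type*} [Fintype ι] [DecidableEq ι] [Fintype κ] [DecidableEq κ]

/-- The operators `K` form a Kraus decomposition `X ↦ ∑ₖ Kₖ X Kₖ†` of `T`. -/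
def IsKraus {α : Type*} [Fintype α] (K : α → Matrix ι ι ℂ) (T : SuperOp ι) : Prop :=
  ∀ X, T X = ∑ k, K k * X * (K k)ᴴ

/-- Two linear maps agree if they agree on all matrix units. -/
theorem linearMap_ext_single {M : Type*} [AddCommGroup M] [Module ℂ M]
    {f g : Matrix ι ι ℂ →ₗ[ℂ] M} (h : ∀ a b, f (Matrix.single a b 1) = g (Matrix.single a b 1)) :
    f = g := by
  refine LinearMap.ext fun X => ?_
  have hX : X = ∑ a, ∑ b, X a b • Matrix.single a b (1 : ℂ) := by
    conv_lhs => rw [Matrix.matrix_eq_sum_single X]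
    simp
  rw [hX]
  simp only [map_sum, map_smul, h]

/-- The Choi matrix of a completely positive map is positive semidefinite. -/
theorem IsCompletelyPositive.posSemidef_choi {T : SuperOp ι} (hT : IsCompletelyPositive T) :
    (Matrix.of fun p q : ι × ι => T (Matrix.single p.2 q.2 1) p.1 q.1).PosSemidef := by
  -- Complete positivity is tested on `Fin k` only, so the second copy of `ι` is relabelled; `v` is
  -- the unnormalised maximally entangled vector.
  let e := Fintype.equivFin ι
  let v : ι × Fin (Fintype.card ι) → ℂ := fun p => if e p.1 = p.2 then 1 else 0
  have h := hT _ _ (Matrix.posSemidef_vecMulVec_self_star v)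
  have h2 := h.submatrix (fun p : ι × ι => (p.1, e p.2))
  convert h2 using 1
  ext p q
  simp only [tensorId, Matrix.of_apply, Matrix.submatrix_apply, LinearMap.coe_mk, AddHom.coe_mk]
  refine congrFun (congrFun (congrArg T ?_) p.1) q.1
  ext a b
  simp only [Matrix.of_apply, Matrix.vecMulVec_apply, Pi.star_apply, v, Matrix.single_apply,
    EmbeddingLike.apply_eq_iff_eq]
  by_cases h1 : a = p.2 <;> by_cases h2 : b = q.2 <;> simp [h1, h2, eq_comm]

/-- Factor the Choi matrix as B† B: each row of B, conjugated and reshaped into a square matrix, is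
a Kraus operator. Kraus operators give positivity of T ⊗ id over any finite index type and pass to
tensor products. -/
theorem IsCompletelyPositive.exists_isKraus {T : SuperOp ι} (hT : IsCompletelyPositive T) :
    ∃ K : ι × ι → Matrix ι ι ℂ, IsKraus K T := by
  obtain ⟨B, hB⟩ := CStarAlgebra.nonneg_iff_eq_star_mul_self.mp hT.posSemidef_choi.nonneg
  refine ⟨fun k => Matrix.of fun a c => star (B k (a, c)), fun X => ?_⟩
  let S : SuperOp ι := ∑ k : ι × ι,
    (LinearMap.mulLeft ℂ (Matrix.of fun a c => star (B k (a, c)))) ∘ₗ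
    (LinearMap.mulRight ℂ (Matrix.of fun a c => star (B k (a, c)))ᴴ)
  have hS (X : Matrix ι ι ℂ) : S X = ∑ k, (Matrix.of fun a c => star (B k (a, c))) * X *
      (Matrix.of fun a c => star (B k (a, c)))ᴴ := by
    simp [S, LinearMap.sum_apply, mul_assoc]
  rw [← hS]
  congr 1
  refine linearMap_ext_single fun c d => ?_
  ext a b
  have h := congrFun (congrFun hB (a, c)) (b, d)
  rw [hS]
  simp only [Matrix.of_apply] at h
  rw [h, Matrix.mul_apply, Matrix.sum_apply]
  refine Finset.sum_congr rfl fun k _ => ?_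
  rw [Matrix.mul_apply, Finset.sum_eq_single d]
  · simp [Matrix.star_apply]
  · intro x _ hx
    simp [Matrix.mul_apply, hx.symm]
  · simp

theorem IsKraus.tensorId_apply {α : Type*} [Fintype α] {K : α → Matrix ι ι ℂ} {T : SuperOp ι}
    (hK : IsKraus K T) (X : Matrix (ι × κ) (ι × κ) ℂ) :
    tensorId T κ X = ∑ k, (K k ⊗ₖ (1 : Matrix κ κ ℂ)) * X * (K k ⊗ₖ (1 : Matrix κ κ ℂ))ᴴ := by
  ext p q
  simp only [tensorId, LinearMap.coe_mk, AddHom.coe_mk, Matrix.of_apply, hK _, Matrix.sum_apply]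
  refine Finset.sum_congr rfl fun k _ => ?_
  simp only [Matrix.mul_apply, Matrix.of_apply, Matrix.conjTranspose_apply, Fintype.sum_prod_type,
    Matrix.kroneckerMap_apply, Matrix.one_apply]
  simp [apply_ite]

theorem IsKraus.posSemidef_tensorId {α : Type*} [Fintype α] {K : α → Matrix ι ι ℂ} {T : SuperOp ι}
    (hK : IsKraus K T) {X : Matrix (ι × κ) (ι × κ) ℂ} (hX : X.PosSemidef) :
    (tensorId T κ X).PosSemidef := by
  rw [hK.tensorId_apply]
  exact Matrix.posSemidef_sum _ fun k _ => hX.mul_mul_conjTranspose_same _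

theorem IsKraus.isCompletelyPositive {α : Type*} [Fintype α] {K : α → Matrix ι ι ℂ}
    {T : SuperOp ι} (hK : IsKraus K T) : IsCompletelyPositive T :=
  fun _ _ hX => hK.posSemidef_tensorId hX

theorem trace_tensorId {T : SuperOp ι} (hT : ∀ X, (T X).trace = X.trace)
    (X : Matrix (ι × κ) (ι × κ) ℂ) : (tensorId T κ X).trace = X.trace := by
  simp only [Matrix.trace, Matrix.diag_apply, Fintype.sum_prod_type, tensorId, LinearMap.coe_mk,
    AddHom.coe_mk, Matrix.of_apply]
  rw [Finset.sum_comm, Finset.sum_comm (γ := ι)]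
  exact Finset.sum_congr rfl fun y _ => hT (Matrix.of fun a b => X (a, y) (b, y))

theorem tensorId_mul (S T : SuperOp ι) : tensorId (S * T) κ = tensorId S κ * tensorId T κ := rfl

theorem tensorId_sub (S T : SuperOp ι) : tensorId (S - T) κ = tensorId S κ - tensorId T κ := rfl

theorem tensorId_pow (T : SuperOp ι) (k : ℕ) : tensorId (T ^ k) κ = tensorId T κ ^ k := by
  induction k with
  | zero => rfl
  | succ k ih => rw [pow_succ, pow_succ, tensorId_mul, ih]

theorem IsChannel.posSemidef_tensorId {T : SuperOp ι} (hT : IsChannel T)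
    {X : Matrix (ι × κ) (ι × κ) ℂ} (hX : X.PosSemidef) : (tensorId T κ X).PosSemidef := by
  obtain ⟨K, hK⟩ := hT.completelyPositive.exists_isKraus
  exact hK.posSemidef_tensorId hX

theorem IsChannel.posSemidef {T : SuperOp ι} (hT : IsChannel T) {X : Matrix ι ι ℂ}
    (hX : X.PosSemidef) : (T X).PosSemidef := by
  obtain ⟨K, hK⟩ := hT.completelyPositive.exists_isKraus
  rw [hK]
  exact Matrix.posSemidef_sum _ fun k _ => hX.mul_mul_conjTranspose_same _

theorem IsChannel.isHermitian {T : SuperOp ι} (hT : IsChannel T) {X : Matrix ι ι ℂ}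
    (hX : X.IsHermitian) : (T X).IsHermitian := by
  obtain ⟨A, B, hA, hB, rfl, -⟩ := exists_posSemidef_sub hX
  rw [map_sub]
  exact (hT.posSemidef hA).isHermitian.sub (hT.posSemidef hB).isHermitian

theorem IsChannel.traceNorm_le {T : SuperOp ι} (hT : IsChannel T) {X : Matrix ι ι ℂ}
    (hX : X.IsHermitian) : traceNorm (T X) ≤ traceNorm X :=
  traceNorm_map_le T (fun _ hA => hT.posSemidef hA) hT.trace_map hX

theorem IsChannel.tensorId {T : SuperOp ι} (hT : IsChannel T) :
    IsChannel (QuantumCutoff.tensorId T κ) := by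
  refine ⟨?_, trace_tensorId hT.trace_map⟩
  obtain ⟨K, hK⟩ := hT.completelyPositive.exists_isKraus
  exact IsKraus.isCompletelyPositive (K := fun k => K k ⊗ₖ (1 : Matrix κ κ ℂ)) hK.tensorId_apply

theorem IsChannel.one : IsChannel (1 : SuperOp ι) :=
  ⟨fun _ _ hX => hX, fun _ => rfl⟩

theorem IsChannel.mul {S T : SuperOp ι} (hS : IsChannel S) (hT : IsChannel T) :
    IsChannel (S * T) :=
  ⟨fun k X hX => hS.completelyPositive k _ (hT.completelyPositive k X hX),
    fun X => (hS.trace_map (T X)).trans (hT.trace_map X)⟩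

theorem IsChannel.pow {T : SuperOp ι} (hT : IsChannel T) (k : ℕ) : IsChannel (T ^ k) := by
  induction k with
  | zero => exact IsChannel.one
  | succ k ih => rw [pow_succ]; exact ih.mul hT

theorem IsChannel.apply_mem_states {T : SuperOp ι} (hT : IsChannel T) {ρ : Matrix ι ι ℂ}
    (hρ : ρ ∈ states ι) : T ρ ∈ states ι :=
  ⟨hT.posSemidef hρ.1, (hT.trace_map ρ).trans hρ.2⟩

theorem tendsto_matrix_iff {α : Type*} {F : Filter α} {X : α → Matrix ι κ ℂ} {Y : Matrix ι κ ℂ} :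
    Tendsto X F (𝓝 Y) ↔ ∀ i j, Tendsto (fun a => X a i j) F (𝓝 (Y i j)) := by
  refine tendsto_pi_nhds.trans (forall_congr' fun i => ?_)
  exact tendsto_pi_nhds

theorem tendsto_tensorId {α : Type*} {F : Filter α} {T : α → SuperOp ι} {S : SuperOp ι}
    (h : ∀ X, Tendsto (fun a => T a X) F (𝓝 (S X))) (X : Matrix (ι × κ) (ι × κ) ℂ) :
    Tendsto (fun a => tensorId (T a) κ X) F (𝓝 (tensorId S κ X)) := by
  rw [tendsto_matrix_iff]
  exact fun p q => tendsto_matrix_iff.mp (h (Matrix.of fun a b => X (a, p.2) (b, q.2))) p.1 q.1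

/-- Pointwise limits of channels are channels. -/
theorem IsChannel.of_tendsto {α : Type*} {F : Filter α} [F.NeBot] {T : α → SuperOp ι}
    {S : SuperOp ι} (hT : ∀ a, IsChannel (T a)) (h : ∀ X, Tendsto (fun a => T a X) F (𝓝 (S X))) :
    IsChannel S := by
  refine ⟨fun k X hX => posSemidef_of_tendsto
    (fun a => (hT a).completelyPositive k X hX) (tendsto_tensorId h X), fun X => ?_⟩
  have hc : Continuous fun M : Matrix ι ι ℂ => M.trace := by fun_prop
  have h1 := (hc.tendsto _).comp (h X)
  refine tendsto_nhds_unique h1 ?_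
  simp only [Function.comp_def, (hT _).trace_map]
  exact tendsto_const_nhds

end Kraus

/-! ### Tensor products of superoperators. -/

section TensorMap

variable {ι : Type*} [Fintype ι] [DecidableEq ι] {n : ℕ}

theorem pureTensor_single (c e : Fin n → ι) :
    pureTensor (fun i => Matrix.single (c i) (e i) (1 : ℂ)) = Matrix.single c e 1 := by
  ext a b
  simp only [pureTensor, Matrix.of_apply, Matrix.single_apply, funext_iff, ← forall_and]
  rw [Finset.prod_ite_zero]
  simp

/-- Two linear maps agree if they agree on all elementary tensors. -/
theorem linearMap_ext_pureTensor {M : Type*} [AddCommGroup M] [Module ℂ M]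
    {f g : Matrix (Fin n → ι) (Fin n → ι) ℂ →ₗ[ℂ] M}
    (h : ∀ X : Fin n → Matrix ι ι ℂ, f (pureTensor X) = g (pureTensor X)) : f = g :=
  linearMap_ext_single fun c e => by rw [← pureTensor_single, h]

theorem pureTensor_mul (X Y : Fin n → Matrix ι ι ℂ) :
    pureTensor X * pureTensor Y = pureTensor (fun i => X i * Y i) := by
  ext a b
  simp only [pureTensor, Matrix.mul_apply, Matrix.of_apply, ← Finset.prod_mul_distrib]
  rw [Finset.prod_univ_sum, Fintype.piFinset_univ]

theorem pureTensor_conjTranspose (X : Fin n → Matrix ι ι ℂ) :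
    (pureTensor X)ᴴ = pureTensor (fun i => (X i)ᴴ) := by
  ext a b
  simp [pureTensor, Matrix.conjTranspose_apply]

theorem pureTensor_one : pureTensor (fun _ : Fin n => (1 : Matrix ι ι ℂ)) = 1 := by
  ext a b
  simp only [pureTensor, Matrix.of_apply, Matrix.one_apply, funext_iff]
  rw [Finset.prod_ite_zero]
  simp

theorem trace_pureTensor (X : Fin n → Matrix ι ι ℂ) :
    (pureTensor X).trace = ∏ i, (X i).trace := by
  simp only [Matrix.trace, Matrix.diag_apply, pureTensor, Matrix.of_apply]
  rw [Finset.prod_univ_sum, Fintype.piFinset_univ]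

theorem pureTensor_sum {α : Type*} [Fintype α] [DecidableEq α] (X : Fin n → α → Matrix ι ι ℂ) :
    pureTensor (fun i => ∑ k, X i k) = ∑ f : Fin n → α, pureTensor (fun i => X i (f i)) := by
  ext a b
  simp only [pureTensor, Matrix.of_apply, Matrix.sum_apply]
  rw [Finset.prod_univ_sum, Fintype.piFinset_univ]

theorem posSemidef_pureTensor {X : Fin n → Matrix ι ι ℂ} (hX : ∀ i, (X i).PosSemidef) :
    (pureTensor X).PosSemidef := by
  choose B hB using fun i => CStarAlgebra.nonneg_iff_eq_star_mul_self.mp (hX i).nonneg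
  have h : pureTensor X = (pureTensor B)ᴴ * pureTensor B := by
    rw [pureTensor_conjTranspose, pureTensor_mul]
    congr 1
    exact funext hB
  rw [h]
  exact Matrix.posSemidef_conjTranspose_mul_self _

theorem pureTensor_mem_states {X : Fin n → Matrix ι ι ℂ} (hX : ∀ i, X i ∈ states ι) :
    pureTensor X ∈ states (Fin n → ι) :=
  ⟨posSemidef_pureTensor fun i => (hX i).1, by
    rw [trace_pureTensor]; exact Finset.prod_eq_one fun i _ => (hX i).2⟩

/-- The tensor product `T₁ ⊗ ⋯ ⊗ Tₙ` of superoperators. -/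
def tensorMap (T : Fin n → SuperOp ι) : SuperOp (Fin n → ι) where
  toFun X := ∑ c, ∑ e, X c e • pureTensor fun i => T i (Matrix.single (c i) (e i) 1)
  map_add' X Y := by simp [add_smul, Finset.sum_add_distrib]
  map_smul' z X := by simp [mul_smul, Finset.smul_sum]

theorem tensorPower_eq_tensorMap (T : SuperOp ι) : tensorPower n T = tensorMap fun _ => T := rfl

theorem tensorMap_single (T : Fin n → SuperOp ι) (c e : Fin n → ι) :
    tensorMap T (Matrix.single c e 1) = pureTensor fun i => T i (Matrix.single (c i) (e i) 1) := by
  simp only [tensorMap, LinearMap.coe_mk, AddHom.coe_mk]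
  rw [Finset.sum_eq_single c, Finset.sum_eq_single e]
  · simp
  · intro x _ hx; simp [hx.symm]
  · simp
  · intro x _ hx; simp [hx.symm]
  · simp

theorem tensorMap_pureTensor (T : Fin n → SuperOp ι) (X : Fin n → Matrix ι ι ℂ) :
    tensorMap T (pureTensor X) = pureTensor fun i => T i (X i) := by
  have hX (i : Fin n) : X i = ∑ p : ι × ι, X i p.1 p.2 • Matrix.single p.1 p.2 (1 : ℂ) := by
    conv_lhs => rw [Matrix.matrix_eq_sum_single (X i)]
    simp [Fintype.sum_prod_type]
  have hs (z : Fin n → ℂ) (Y : Fin n → Matrix ι ι ℂ) :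
      pureTensor (fun i => z i • Y i) = (∏ i, z i) • pureTensor Y := by
    ext a b
    simp [pureTensor, Finset.prod_mul_distrib]
  have h1 : pureTensor X = pureTensor fun i =>
      ∑ p : ι × ι, X i p.1 p.2 • Matrix.single p.1 p.2 (1 : ℂ) := by
    congr 1; exact funext hX
  have h2 : (pureTensor fun i => T i (X i)) = pureTensor fun i =>
      ∑ p : ι × ι, X i p.1 p.2 • T i (Matrix.single p.1 p.2 (1 : ℂ)) := by
    congr 1
    funext i
    conv_lhs => rw [hX i]
    simp only [map_sum, map_smul]
  rw [h1, h2, pureTensor_sum, pureTensor_sum, map_sum]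
  refine Finset.sum_congr rfl fun f _ => ?_
  rw [hs, hs, map_smul, pureTensor_single, tensorMap_single]

theorem tensorMap_mul (S T : Fin n → SuperOp ι) :
    tensorMap (fun i => S i * T i) = tensorMap S * tensorMap T :=
  linearMap_ext_pureTensor fun X => by simp [tensorMap_pureTensor]

theorem tensorMap_one : tensorMap (fun _ : Fin n => (1 : SuperOp ι)) = 1 :=
  linearMap_ext_pureTensor fun X => by simp [tensorMap_pureTensor]

theorem tensorPower_mul (S T : SuperOp ι) :
    tensorPower n (S * T) = tensorPower n S * tensorPower n T :=
  tensorMap_mul (fun _ => S) fun _ => T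

theorem tensorPower_pow (T : SuperOp ι) (k : ℕ) :
    tensorPower n (T ^ k) = tensorPower n T ^ k := by
  induction k with
  | zero => exact tensorMap_one
  | succ k ih => rw [pow_succ, pow_succ, tensorPower_mul, ih]

/-- Choosing one Kraus operator per factor, in all possible ways, gives Kraus operators of the
product. The factors may differ because the telescoping argument mixes several channels. -/
theorem isChannel_tensorMap {T : Fin n → SuperOp ι} (hT : ∀ i, IsChannel (T i)) :
    IsChannel (tensorMap T) := by
  choose K hK using fun i => (hT i).completelyPositive.exists_isKraus
  constructor
  · refine IsKraus.isCompletelyPositive (α := Fin n → ι × ι)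
      (K := fun f => pureTensor fun i => K i (f i)) fun X => ?_
    let S : SuperOp (Fin n → ι) := ∑ f : Fin n → ι × ι,
      (LinearMap.mulLeft ℂ (pureTensor fun i => K i (f i))) ∘ₗ
      (LinearMap.mulRight ℂ (pureTensor fun i => K i (f i))ᴴ)
    have hS (X : Matrix (Fin n → ι) (Fin n → ι) ℂ) : S X = ∑ f : Fin n → ι × ι,
        (pureTensor fun i => K i (f i)) * X * (pureTensor fun i => K i (f i))ᴴ := by
      simp [S, LinearMap.sum_apply, mul_assoc]
    rw [← hS]
    congr 1
    refine linearMap_ext_pureTensor fun X => ?_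
    rw [hS, tensorMap_pureTensor]
    simp only [pureTensor_conjTranspose, pureTensor_mul]
    rw [← pureTensor_sum fun i k => K i k * X i * (K i k)ᴴ]
    congr 1
    exact funext fun i => hK i (X i)
  · intro X
    have h : Matrix.traceLinearMap (Fin n → ι) ℂ ℂ ∘ₗ tensorMap T
        = Matrix.traceLinearMap (Fin n → ι) ℂ ℂ :=
      linearMap_ext_pureTensor fun X => by
        simp [tensorMap_pureTensor, trace_pureTensor, (hT _).trace_map]
    exact LinearMap.congr_fun h X

theorem IsChannel.tensorPower {T : SuperOp ι} (hT : IsChannel T) :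
    IsChannel (QuantumCutoff.tensorPower n T) := isChannel_tensorMap fun _ => hT

theorem tendsto_tensorPower {α : Type*} {F : Filter α} {T : α → SuperOp ι} {S : SuperOp ι}
    (h : ∀ X, Tendsto (fun a => T a X) F (𝓝 (S X))) (X : Matrix (Fin n → ι) (Fin n → ι) ℂ) :
    Tendsto (fun a => tensorPower n (T a) X) F (𝓝 (tensorPower n S X)) := by
  refine tendsto_finsetSum _ fun c _ => tendsto_finsetSum _ fun e _ =>
    Tendsto.const_smul (tendsto_matrix_iff.mpr fun a b => ?_) _
  simp only [pureTensor, Matrix.of_apply]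
  exact tendsto_finsetProd _ fun i _ => tendsto_matrix_iff.mp (h _) _ _

end TensorMap

/-! ### Decay of matrix powers from the spectral radius. -/

section PowerDecay

attribute [local instance] Matrix.linftyOpNormedRing Matrix.linftyOpNormedAlgebra

theorem norm_apply_le_linftyOpNorm {m : Type*} [Fintype m] [DecidableEq m] (A : Matrix m m ℂ)
    (i j : m) : ‖A i j‖ ≤ ‖A‖ := by
  have h : ∑ j, ‖A i j‖₊ ≤ ‖A‖₊ := by
    rw [Matrix.linfty_opNNNorm_def]
    exact Finset.le_sup (f := fun i => ∑ j, ‖A i j‖₊) (Finset.mem_univ i)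
  exact_mod_cast (Finset.single_le_sum (f := fun j => ‖A i j‖₊) (fun _ _ => zero_le)
    (Finset.mem_univ j)).trans h

/-- By Gelfand's formula ‖A^k‖^(1/k) is eventually below r; the finitely many remaining exponents
are absorbed in C. -/
theorem exists_norm_matrix_pow_le {m : Type*} [Fintype m] [DecidableEq m] (A : Matrix m m ℂ)
    {r : ℝ} (hr : 0 < r) (h : ∀ ν ∈ spectrum ℂ A, ‖ν‖ < r) :
    ∃ C, 0 ≤ C ∧ ∀ (k : ℕ) i j, ‖(A ^ k) i j‖ ≤ C * r ^ k := by
  rcases isEmpty_or_nonempty m with hm | hm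
  · exact ⟨0, le_rfl, fun k i => hm.elim i⟩
  lift r to NNReal using hr.le
  have h1 : spectralRadius ℂ A < r :=
    spectrum.spectralRadius_lt_of_forall_lt A fun ν hν => h ν hν
  have h2 := (spectrum.pow_nnnorm_pow_one_div_tendsto_nhds_spectralRadius A).eventually_lt_const h1
  have h3 : (fun k : ℕ => ‖A ^ k‖) =O[atTop] fun k => (r : ℝ) ^ k := by
    refine IsBigO.of_bound 1 ?_
    filter_upwards [h2, eventually_gt_atTop 0] with k hk hk0
    have h4 : ((‖A ^ k‖₊ : ENNReal) ^ (1 / k : ℝ)) ^ (k : ℝ) ≤ (r : ENNReal) ^ (k : ℝ) :=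
      ENNReal.rpow_le_rpow hk.le (by positivity)
    rw [← ENNReal.rpow_mul, one_div, inv_mul_cancel₀ (by positivity), ENNReal.rpow_one,
      ENNReal.rpow_natCast] at h4
    have h5 : ‖A ^ k‖ ≤ (r : ℝ) ^ k := by exact_mod_cast h4
    simpa using h5
  obtain ⟨C, hC, hb⟩ := bound_of_isBigO_nat_atTop h3
  refine ⟨C, hC.le, fun k i j => (norm_apply_le_linftyOpNorm _ i j).trans ?_⟩
  have := hb (x := k) (by positivity)
  simpa using this

end PowerDecay

/-! ### Peripheral spectrum and asymptotic evolution. -/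

section Spectral

variable {ι : Type*} [Fintype ι] [DecidableEq ι]

theorem exists_norm_pow_apply_le (S : SuperOp ι) {r : ℝ} (hr : 0 < r)
    (h : ∀ ν, S.HasEigenvalue ν → ‖ν‖ < r) :
    ∃ C, 0 ≤ C ∧ ∀ (k : ℕ) X i j, ‖(S ^ k) X i j‖ ≤ C * r ^ k * ∑ a, ∑ b, ‖X a b‖ := by
  let φ := LinearMap.toMatrixAlgEquiv (Matrix.stdBasis ℂ ι ι)
  obtain ⟨C, hC, hb⟩ := exists_norm_matrix_pow_le (φ S) hr fun ν hν => by
    rw [AlgEquiv.spectrum_eq] at hν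
    exact h ν (Module.End.hasEigenvalue_iff_mem_spectrum.mpr hν)
  refine ⟨C, hC, fun k X i j => ?_⟩
  have hX : X = ∑ a, ∑ b, X a b • Matrix.single a b (1 : ℂ) := by
    conv_lhs => rw [Matrix.matrix_eq_sum_single X]
    simp
  have hE (a b : ι) : (S ^ k) (Matrix.single a b 1) i j = (φ S ^ k) (i, j) (a, b) := by
    rw [← map_pow, LinearMap.toMatrixAlgEquiv_apply, Matrix.stdBasis_eq_single]
    rfl
  conv_lhs => rw [hX]
  simp only [map_sum, map_smul, Matrix.sum_apply, Matrix.smul_apply, hE, smul_eq_mul,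
    Finset.mul_sum]
  refine (norm_sum_le _ _).trans (Finset.sum_le_sum fun a _ => (norm_sum_le _ _).trans
    (Finset.sum_le_sum fun b _ => ?_))
  rw [norm_mul, mul_comm]
  gcongr
  exact hb _ _ _

/-- All orbits `k ↦ T ^ k X` are bounded. -/
def PowerBounded (T : SuperOp ι) : Prop :=
  ∀ X, ∃ C, ∀ (k : ℕ) i j, ‖(T ^ k) X i j‖ ≤ C

/-- Powers of T preserve positivity and trace, and the trace bounds the entries of a positive
semidefinite matrix. -/
theorem IsChannel.powerBounded {T : SuperOp ι} (hT : IsChannel T) : PowerBounded T := by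
  intro X
  obtain ⟨A, B, C, D, hA, hB, hC, hD, rfl⟩ := exists_posSemidef_combination X
  refine ⟨A.trace.re + B.trace.re + (C.trace.re + D.trace.re), fun k i j => ?_⟩
  have h {Y : Matrix ι ι ℂ} (hY : Y.PosSemidef) : ‖(T ^ k) Y i j‖ ≤ Y.trace.re := by
    rw [← (hT.pow k).trace_map]
    exact norm_apply_le_trace ((hT.pow k).posSemidef hY) i j
  simp only [map_add, map_sub, map_smul, Matrix.add_apply, Matrix.sub_apply, Matrix.smul_apply]
  refine (norm_add_le _ _).trans (add_le_add ?_ ?_)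
  · exact (norm_sub_le _ _).trans (add_le_add (h hA) (h hB))
  · rw [norm_smul, Complex.norm_I, one_mul]
    exact (norm_sub_le _ _).trans (add_le_add (h hC) (h hD))

theorem exists_apply_ne_zero {X : Matrix ι ι ℂ} (hX : X ≠ 0) : ∃ i j, X i j ≠ 0 := by
  by_contra! h
  exact hX (Matrix.ext h)

theorem pow_apply_of_eigen {T : SuperOp ι} {μ : ℂ} {v : Matrix ι ι ℂ} (h : T v = μ • v) (k : ℕ) :
    (T ^ k) v = μ ^ k • v := by
  induction k with
  | zero => simp
  | succ k ih => rw [pow_succ, Module.End.mul_apply, h, map_smul, ih, smul_smul, pow_succ']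

theorem PowerBounded.norm_le_one {T : SuperOp ι} (hT : PowerBounded T) {μ : ℂ}
    (hμ : T.HasEigenvalue μ) : ‖μ‖ ≤ 1 := by
  obtain ⟨v, hv⟩ := hμ.exists_hasEigenvector
  obtain ⟨i, j, hij⟩ := exists_apply_ne_zero hv.2
  obtain ⟨C, hC⟩ := hT v
  by_contra! h
  have h1 := (tendsto_pow_atTop_atTop_of_one_lt h).atTop_mul_const (norm_pos_iff.mpr hij)
  obtain ⟨k, hk⟩ := (h1.eventually_gt_atTop C).exists
  have := hC k i j
  rw [pow_apply_of_eigen hv.apply_eq_smul, Matrix.smul_apply, norm_smul, norm_pow] at this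
  linarith

/-- A power-bounded map has no Jordan chain of length two for a peripheral eigenvalue. -/
theorem PowerBounded.eigen_of_chain {T : SuperOp ι} (hT : PowerBounded T) {μ : ℂ} (hμ : ‖μ‖ = 1)
    {v w : Matrix ι ι ℂ} (hv : T v = μ • v + w) (hw : T w = μ • w) : w = 0 := by
  by_contra h0
  have hμ0 : μ ≠ 0 := by rintro rfl; simp at hμ
  -- A chain of length two forces linear growth in k. The coefficient k μ^(k-1) is written with μ⁻¹
  -- to avoid truncated subtraction at k = 0.
  have key (k : ℕ) : (T ^ k) v = μ ^ k • v + (k * μ ^ k * μ⁻¹) • w := by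
    induction k with
    | zero => simp
    | succ k ih =>
      rw [pow_succ', Module.End.mul_apply, ih, map_add, map_smul, map_smul, hv, hw, smul_add,
        smul_smul, smul_smul, add_assoc, ← add_smul]
      congr 2
      push_cast
      field_simp
      ring
  obtain ⟨i, j, hij⟩ := exists_apply_ne_zero h0
  obtain ⟨C, hC⟩ := hT v
  have h1 := (tendsto_natCast_atTop_atTop (R := ℝ)).atTop_mul_const (norm_pos_iff.mpr hij)
  obtain ⟨k, hk⟩ := (h1.eventually_gt_atTop (C + ‖v i j‖)).exists
  have h2 := hC k i j
  rw [key, Matrix.add_apply, Matrix.smul_apply, Matrix.smul_apply] at h2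
  have h3 := norm_sub_norm_le ((k * μ ^ k * μ⁻¹) • w i j) (-(μ ^ k • v i j))
  rw [sub_neg_eq_add, add_comm (_ • w i j), norm_neg, norm_smul, norm_smul] at h3
  simp only [norm_mul, norm_pow, norm_inv, hμ, one_pow, inv_one, mul_one, one_mul,
    Complex.norm_natCast] at h3
  linarith

/-- Induction on the order of v: by hypothesis (T - μ) v is already an eigenvector, so v starts a
chain of length two and (T - μ) v = 0. -/
theorem PowerBounded.maxGenEigenspace_eq {T : SuperOp ι} (hT : PowerBounded T) {μ : ℂ}
    (hμ : ‖μ‖ = 1) {v : Matrix ι ι ℂ} (hv : v ∈ T.maxGenEigenspace μ) : T v = μ • v := by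
  obtain ⟨k, hk⟩ := (Module.End.mem_maxGenEigenspace _ _ _).mp hv
  induction k generalizing v with
  | zero =>
    have : v = 0 := by simpa using hk
    simp [this]
  | succ k ih =>
    rw [pow_succ, Module.End.mul_apply] at hk
    have hw : T ((T - μ • 1) v) = μ • ((T - μ • 1) v) :=
      ih ((Module.End.mem_maxGenEigenspace _ _ _).mpr ⟨k, hk⟩) hk
    have h0 := hT.eigen_of_chain hμ (v := v) (w := (T - μ • 1) v) (by simp) hw
    simpa [sub_eq_zero] using h0

theorem jordanProj_apply_mem (T : SuperOp ι) (μ : ℂ) (X : Matrix ι ι ℂ) :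
    jordanProj T μ X ∈ T.maxGenEigenspace μ :=
  Submodule.projection_apply_mem _ X

theorem jordanProj_of_mem {T : SuperOp ι} {μ : ℂ} {X : Matrix ι ι ℂ}
    (hX : X ∈ T.maxGenEigenspace μ) : jordanProj T μ X = X :=
  Submodule.projection_apply_of_mem_left _ hX

theorem jordanProj_of_mem_ne {T : SuperOp ι} {μ ν : ℂ} (h : ν ≠ μ) {X : Matrix ι ι ℂ}
    (hX : X ∈ T.maxGenEigenspace ν) : jordanProj T μ X = 0 :=
  (Submodule.projection_apply_eq_zero_iff _).mpr
    ((le_iSup₂_of_le (f := fun ν (_ : ν ≠ μ) => T.maxGenEigenspace ν) ν h le_rfl) hX)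

theorem jordanProj_commute (T : SuperOp ι) (μ : ℂ) (X : Matrix ι ι ℂ) :
    jordanProj T μ (T X) = T (jordanProj T μ X) := by
  have hX : X ∈ ⨆ ν, T.maxGenEigenspace ν := by
    rw [Module.End.iSup_maxGenEigenspace_eq_top]; trivial
  induction hX using Submodule.iSup_induction' with
  | mem ν x hx =>
    have h1 : T x ∈ T.maxGenEigenspace ν :=
      Module.End.mapsTo_maxGenEigenspace_of_comm (Commute.refl T) ν hx
    by_cases h : ν = μ
    · subst h
      rw [jordanProj_of_mem hx, jordanProj_of_mem h1]
    · rw [jordanProj_of_mem_ne h hx, jordanProj_of_mem_ne h h1, map_zero]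
  | zero => simp
  | add x y _ _ hx hy => simp [hx, hy]

theorem jordanProj_pow_commute (T : SuperOp ι) (μ : ℂ) (k : ℕ) (X : Matrix ι ι ℂ) :
    jordanProj T μ ((T ^ k) X) = (T ^ k) (jordanProj T μ X) := by
  induction k generalizing X with
  | zero => rfl
  | succ k ih => rw [pow_succ, Module.End.mul_apply, Module.End.mul_apply, ih, jordanProj_commute]

/-- The projection onto the sum of the peripheral generalized eigenspaces. -/
def peripheralProj (T : SuperOp ι) : SuperOp ι :=
  ∑ μ ∈ (finite_peripheral T).toFinset, jordanProj T μ

theorem peripheralProj_apply (T : SuperOp ι) (X : Matrix ι ι ℂ) :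
    peripheralProj T X = ∑ μ ∈ (finite_peripheral T).toFinset, jordanProj T μ X := by
  simp [peripheralProj, LinearMap.sum_apply]

theorem peripheralProj_of_mem {T : SuperOp ι} {μ : ℂ} (hμ : T.HasEigenvalue μ) (h1 : ‖μ‖ = 1)
    {X : Matrix ι ι ℂ} (hX : X ∈ T.maxGenEigenspace μ) : peripheralProj T X = X := by
  rw [peripheralProj_apply, Finset.sum_eq_single μ, jordanProj_of_mem hX]
  · exact fun ν _ hν => jordanProj_of_mem_ne hν.symm hX
  · intro h
    simp [hμ, h1] at h

theorem isIdempotentElem_peripheralProj (T : SuperOp ι) : IsIdempotentElem (peripheralProj T) := by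
  refine LinearMap.ext fun X => ?_
  rw [Module.End.mul_apply]
  conv_lhs => rw [peripheralProj_apply T X, map_sum]
  rw [peripheralProj_apply T X]
  refine Finset.sum_congr rfl fun μ hμ => ?_
  simp only [Set.Finite.mem_toFinset, Set.mem_ofPred_eq] at hμ
  exact peripheralProj_of_mem hμ.1 hμ.2 (jordanProj_apply_mem T μ X)

theorem peripheralProj_commute (T : SuperOp ι) : Commute (peripheralProj T) T := by
  refine LinearMap.ext fun X => ?_
  simp only [Module.End.mul_apply, peripheralProj_apply, map_sum, jordanProj_commute]

theorem PowerBounded.pow_mul_peripheralProj {T : SuperOp ι} (hT : PowerBounded T) (k : ℕ) :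
    T ^ k * peripheralProj T = ∑ μ ∈ (finite_peripheral T).toFinset, μ ^ k • jordanProj T μ := by
  rw [peripheralProj, Finset.mul_sum]
  refine Finset.sum_congr rfl fun μ hμ => LinearMap.ext fun X => ?_
  simp only [Set.Finite.mem_toFinset, Set.mem_ofPred_eq] at hμ
  rw [Module.End.mul_apply, LinearMap.smul_apply]
  exact pow_apply_of_eigen (hT.maxGenEigenspace_eq hμ.2 (jordanProj_apply_mem T μ X)) k

/-- Without peripheral Jordan blocks T acts as the scalar μ on the range of each peripheral P_μ.
Hence only the projection P has to be understood from here on. -/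
theorem PowerBounded.asymptotic_eq {T : SuperOp ι} (hT : PowerBounded T) :
    asymptotic T = T * peripheralProj T := by
  have := hT.pow_mul_peripheralProj 1
  simp only [pow_one] at this
  exact this.symm

/-- The exponent starts at 1, since the zeroth power on the left would be the identity instead of 1
- P. -/
theorem mul_one_sub_peripheralProj_pow (T : SuperOp ι) (k : ℕ) :
    (T * (1 - peripheralProj T)) ^ (k + 1) = T ^ (k + 1) * (1 - peripheralProj T) := by
  have hc : Commute T (1 - peripheralProj T) :=
    (Commute.one_right T).sub_right (peripheralProj_commute T).symm
  rw [hc.mul_pow, (isIdempotentElem_peripheralProj T).one_sub.pow_succ_eq]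

/-- Away from the peripheral spectrum every eigenvalue is a non-peripheral eigenvalue of `T`. -/
theorem hasEigenvalue_of_mul_one_sub {T : SuperOp ι} (hT : PowerBounded T) {ν : ℂ} (h0 : ν ≠ 0)
    (hν : (T * (1 - peripheralProj T)).HasEigenvalue ν) : T.HasEigenvalue ν ∧ ‖ν‖ < 1 := by
  obtain ⟨v, hv⟩ := hν.exists_hasEigenvector
  have hP := isIdempotentElem_peripheralProj T
  have hc : Commute T (1 - peripheralProj T) :=
    (Commute.one_right T).sub_right (peripheralProj_commute T).symm
  have h1 := hv.apply_eq_smul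
  -- T (1 - P) takes values in the kernel of P, so an eigenvector with ν ≠ 0 lies there. A
  -- peripheral ν would put v in the range of P as well.
  have h2 : peripheralProj T v = 0 := by
    have h3 : peripheralProj T * (T * (1 - peripheralProj T)) = 0 := by
      rw [hc.eq, ← mul_assoc, mul_sub, mul_one, hP.eq, sub_self, zero_mul]
    have h4 := LinearMap.congr_fun h3 v
    rw [Module.End.mul_apply, h1, map_smul, LinearMap.zero_apply] at h4
    exact (smul_eq_zero.mp h4).resolve_left h0
  have h5 : T v = ν • v := by
    rw [← h1, Module.End.mul_apply, LinearMap.sub_apply, h2, Module.End.one_apply, sub_zero]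
  have h6 : T.HasEigenvector ν v := Module.End.hasEigenvector_iff.mpr
    ⟨Module.End.mem_eigenspace_iff.mpr h5, hv.2⟩
  have h7 := Module.End.hasEigenvalue_of_hasEigenvector h6
  refine ⟨h7, lt_of_le_of_ne (hT.norm_le_one h7) fun h8 => hv.2 ?_⟩
  rw [← peripheralProj_of_mem h7 h8 (Module.End.eigenspace_le_maxGenEigenspace h6.1), h2]

/-- If the non-peripheral eigenvalues have modulus less than `r`, then `T ^ k (1 - P)` decays like
`r ^ k`. -/
theorem PowerBounded.exists_norm_le {T : SuperOp ι} (hT : PowerBounded T) {r : ℝ} (hr : 0 < r)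
    (h : ∀ ν, T.HasEigenvalue ν → ‖ν‖ < 1 → ‖ν‖ < r) :
    ∃ C, 0 ≤ C ∧ ∀ (k : ℕ) X i j,
      ‖(T ^ (k + 1)) ((1 - peripheralProj T) X) i j‖ ≤ C * r ^ (k + 1) * ∑ a, ∑ b, ‖X a b‖ := by
  obtain ⟨C, hC, hb⟩ := exists_norm_pow_apply_le (T * (1 - peripheralProj T)) hr fun ν hν => by
    by_cases h0 : ν = 0
    · simpa [h0] using hr
    · obtain ⟨h1, h2⟩ := hasEigenvalue_of_mul_one_sub hT h0 hν
      exact h ν h1 h2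
  refine ⟨C, hC, fun k X i j => ?_⟩
  have := hb (k + 1) X i j
  rwa [mul_one_sub_peripheralProj_pow] at this

theorem PowerBounded.tendsto_zero {T : SuperOp ι} (hT : PowerBounded T) (X : Matrix ι ι ℂ) :
    Tendsto (fun k : ℕ => (T ^ k) ((1 - peripheralProj T) X)) atTop (𝓝 0) := by
  obtain ⟨r, hr0, hr1, hr⟩ : ∃ r : ℝ, 0 < r ∧ r < 1 ∧
      ∀ ν, T.HasEigenvalue ν → ‖ν‖ < 1 → ‖ν‖ < r := by
    let s : Finset ℂ := ((Module.End.finite_hasEigenvalue T).subset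
      (t := {ν | T.HasEigenvalue ν ∧ ‖ν‖ < 1}) fun _ h => h.1).toFinset
    -- There are finitely many non-peripheral eigenvalues; inserting 0 makes the set nonempty and
    -- forces r > 0.
    obtain ⟨r, hr, hr1⟩ : ∃ r : ℝ, (∀ x ∈ insert 0 (s.image fun ν => ‖ν‖), x < r) ∧ r < 1 := by
      let m := (insert 0 (s.image fun ν => ‖ν‖)).max' (Finset.insert_nonempty _ _)
      have hm : m < 1 := by
        rw [Finset.max'_lt_iff]
        intro y hy
        rcases Finset.mem_insert.mp hy with rfl | hy
        · exact one_pos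
        · obtain ⟨ν, hν, rfl⟩ := Finset.mem_image.mp hy
          simp only [s, Set.Finite.mem_toFinset, Set.mem_ofPred_eq] at hν
          exact hν.2
      obtain ⟨r, h1, h2⟩ := exists_between hm
      exact ⟨r, fun x hx => (Finset.le_max' _ x hx).trans_lt h1, h2⟩
    refine ⟨r, hr 0 (by simp), hr1, fun ν h1 h2 => hr _ ?_⟩
    exact Finset.mem_insert_of_mem (Finset.mem_image_of_mem _ (by simp [s, h1, h2]))
  obtain ⟨C, hC, hb⟩ := hT.exists_norm_le hr0 hr
  rw [← tendsto_add_atTop_iff_nat 1, tendsto_matrix_iff]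
  intro i j
  refine squeeze_zero_norm (fun k => hb k X i j) ?_
  have h1 := (tendsto_pow_atTop_nhds_zero_of_lt_one hr0.le hr1).comp (tendsto_add_atTop_nat 1)
  have := (h1.const_mul C).mul_const (∑ a, ∑ b, ‖X a b‖)
  simpa using this

/-- The peripheral projection is a limit of powers of `T` along a filter finer than `atTop`. -/
theorem PowerBounded.exists_tendsto_peripheralProj {T : SuperOp ι} (hT : PowerBounded T) :
    ∃ F : Filter ℕ, F.NeBot ∧ F ≤ atTop ∧
      ∀ X, Tendsto (fun k => (T ^ k) X) F (𝓝 (peripheralProj T X)) := by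
  let s := (finite_peripheral T).toFinset
  have hs (μ : s) : ‖(μ : ℂ)‖ = 1 := ((finite_peripheral T).mem_toFinset.mp μ.2).2
  let x : s → Circle := fun μ => ⟨μ, by rw [Submonoid.unitSphere, ← SetLike.mem_coe]; simp [hs]⟩
  -- Recurrence in the compact torus: 1 is a cluster point of the powers of the tuple of peripheral
  -- eigenvalues, so along some ultrafilter all μ^k tend to 1 simultaneously.
  have hx := mapClusterPt_one_atTop_pow x
  obtain ⟨U, hU, hU2⟩ := mapClusterPt_iff_ultrafilter.mp hx
  refine ⟨U, inferInstance, hU, fun X => ?_⟩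
  have h1 : Tendsto (fun k => (T ^ k) ((1 - peripheralProj T) X)) U (𝓝 0) :=
    (hT.tendsto_zero X).mono_left hU
  have h2 : Tendsto (fun k => (T ^ k) (peripheralProj T X)) U (𝓝 (peripheralProj T X)) := by
    have h3 (k : ℕ) : (T ^ k) (peripheralProj T X) = ∑ μ : s, (μ : ℂ) ^ k • jordanProj T μ X := by
      have := LinearMap.congr_fun (hT.pow_mul_peripheralProj k) X
      rw [Module.End.mul_apply, LinearMap.sum_apply] at this
      rw [this, ← Finset.sum_coe_sort]
      rfl
    simp only [h3]
    rw [peripheralProj_apply, ← Finset.sum_coe_sort]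
    refine tendsto_finsetSum _ fun μ _ => ?_
    have h4 : Tendsto (fun k => ((x ^ k) μ : ℂ)) U (𝓝 1) := by
      have hc : Continuous fun y : s → Circle => (y μ : ℂ) := by fun_prop
      have := (hc.tendsto 1).comp hU2
      simpa [Function.comp_def] using this
    have h5 : Tendsto (fun k => (μ : ℂ) ^ k • jordanProj T μ X) U
        (𝓝 ((1 : ℂ) • jordanProj T μ X)) := by
      refine Tendsto.smul_const (h4.congr fun k => ?_) _
      rw [Pi.pow_apply, Circle.coe_pow]
    simpa using h5
  have h6 := h1.add h2
  rw [zero_add] at h6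
  refine h6.congr fun k => ?_
  rw [← map_add, LinearMap.sub_apply, Module.End.one_apply, sub_add_cancel]

/-- The peripheral projection is the only idempotent limit of powers of `T`. -/
theorem PowerBounded.peripheralProj_eq {T : SuperOp ι} (hT : PowerBounded T) {Q : SuperOp ι}
    (hQ : IsIdempotentElem Q) {F : Filter ℕ} [F.NeBot] (hF : F ≤ atTop)
    (h : ∀ X, Tendsto (fun k => (T ^ k) X) F (𝓝 (Q X))) : peripheralProj T = Q := by
  have hcont (S : SuperOp ι) : Continuous S := LinearMap.continuous_of_finiteDimensional S
  -- On the range of 1 - P the powers of T tend to 0, so Q vanishes there.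
  have h1 (X : Matrix ι ι ℂ) : Q ((1 - peripheralProj T) X) = 0 :=
    tendsto_nhds_unique (h _) ((hT.tendsto_zero X).mono_left hF)
  have hJQ (μ : ℂ) (X : Matrix ι ι ℂ) : jordanProj T μ (Q X) = Q (jordanProj T μ X) := by
    refine tendsto_nhds_unique (((hcont (jordanProj T μ)).tendsto _).comp (h X)) ?_
    refine (h (jordanProj T μ X)).congr fun k => ?_
    simp [jordanProj_pow_commute]
  -- On the range of a peripheral P_μ the powers of T keep the modulus of every entry, yet they send
  -- P_μ Y to P_μ Q Y = 0.
  have h2 (μ : ℂ) (hμ : ‖μ‖ = 1) (X : Matrix ι ι ℂ) : jordanProj T μ ((1 - Q) X) = 0 := by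
    set Y := (1 - Q) X with hY
    have hQY : Q Y = 0 := by
      rw [hY, ← Module.End.mul_apply, mul_sub, mul_one, hQ.eq, sub_self, LinearMap.zero_apply]
    have h3 := h (jordanProj T μ Y)
    rw [← hJQ, hQY, map_zero] at h3
    have h4 (k : ℕ) := pow_apply_of_eigen
      (hT.maxGenEigenspace_eq hμ (jordanProj_apply_mem T μ Y)) k
    simp only [h4] at h3
    ext i j
    have h5 := (tendsto_matrix_iff.mp h3 i j).norm
    simp only [Matrix.smul_apply, norm_smul, norm_pow, hμ, one_pow, one_mul,
      Matrix.zero_apply, norm_zero] at h5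
    exact norm_eq_zero.mp (tendsto_nhds_unique tendsto_const_nhds h5)
  have h6 (X : Matrix ι ι ℂ) : peripheralProj T ((1 - Q) X) = 0 := by
    rw [peripheralProj_apply]
    exact Finset.sum_eq_zero fun μ hμ => h2 μ (((finite_peripheral T).mem_toFinset.mp hμ).2) X
  refine LinearMap.ext fun X => ?_
  -- Now P = P Q = Q P = Q.
  have h7 : peripheralProj T (Q X) = Q (peripheralProj T X) := by
    simp only [peripheralProj_apply, map_sum, hJQ]
  have h8 := h1 X
  have h9 := h6 X
  rw [LinearMap.sub_apply, Module.End.one_apply, map_sub, sub_eq_zero] at h8 h9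
  rw [h9, h7, h8]

theorem PowerBounded.asymptotic_eq_of_tendsto {T : SuperOp ι} (hT : PowerBounded T)
    {Q : SuperOp ι} (hQ : IsIdempotentElem Q) {F : Filter ℕ} [F.NeBot] (hF : F ≤ atTop)
    (h : ∀ X, Tendsto (fun k => (T ^ k) X) F (𝓝 (Q X))) : asymptotic T = T * Q := by
  rw [hT.asymptotic_eq, hT.peripheralProj_eq hQ hF h]

theorem IsChannel.peripheralProj {T : SuperOp ι} (hT : IsChannel T) :
    IsChannel (QuantumCutoff.peripheralProj T) := by
  obtain ⟨F, _, -, h⟩ := hT.powerBounded.exists_tendsto_peripheralProj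
  exact IsChannel.of_tendsto (fun k => hT.pow k) h

theorem IsChannel.asymptotic {T : SuperOp ι} (hT : IsChannel T) :
    IsChannel (QuantumCutoff.asymptotic T) := by
  rw [hT.powerBounded.asymptotic_eq]
  exact hT.mul hT.peripheralProj

/-- If T^k → P along a filter, then (T ⊗ id)^k → P ⊗ id along the same filter, and P ⊗ id is
idempotent, so uniqueness identifies it as the peripheral projection. The tensor power is treated
the same way; no bookkeeping of products of eigenvalues is needed. -/
theorem IsChannel.asymptotic_tensorId {κ : Type*} [Fintype κ] [DecidableEq κ] {T : SuperOp ι}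
    (hT : IsChannel T) : QuantumCutoff.asymptotic (QuantumCutoff.tensorId T κ)
      = QuantumCutoff.tensorId (QuantumCutoff.asymptotic T) κ := by
  obtain ⟨F, _, hF, h⟩ := hT.powerBounded.exists_tendsto_peripheralProj
  rw [hT.powerBounded.asymptotic_eq, tensorId_mul]
  refine hT.tensorId.powerBounded.asymptotic_eq_of_tendsto ?_ hF fun X => ?_
  · rw [IsIdempotentElem, ← tensorId_mul, (isIdempotentElem_peripheralProj T).eq]
  · exact (tendsto_tensorId h X).congr fun k => by rw [tensorId_pow]

theorem IsChannel.asymptotic_tensorPower {n : ℕ} {T : SuperOp ι} (hT : IsChannel T) :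
    QuantumCutoff.asymptotic (QuantumCutoff.tensorPower n T)
      = QuantumCutoff.tensorPower n (QuantumCutoff.asymptotic T) := by
  obtain ⟨F, _, hF, h⟩ := hT.powerBounded.exists_tendsto_peripheralProj
  rw [hT.powerBounded.asymptotic_eq, tensorPower_mul]
  refine hT.tensorPower.powerBounded.asymptotic_eq_of_tendsto ?_ hF fun X => ?_
  · rw [IsIdempotentElem, ← tensorPower_mul, (isIdempotentElem_peripheralProj T).eq]
  · exact (tendsto_tensorPower h X).congr fun k => by rw [tensorPower_pow]

theorem traceDist_le_one {ρ σ : Matrix ι ι ℂ} (hρ : ρ ∈ states ι) (hσ : σ ∈ states ι) :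
    traceDist ρ σ ≤ 1 := by
  have := traceNorm_sub_le hρ.1 hσ.1
  rw [hρ.2, hσ.2] at this
  simp only [Complex.one_re] at this
  rw [traceDist]
  linarith

theorem IsChannel.bddAbove {T : SuperOp ι} (hT : IsChannel T) :
    BddAbove ((fun ρ => traceDist (T ρ) (QuantumCutoff.asymptotic T ρ)) '' states ι) := by
  refine ⟨1, ?_⟩
  rintro - ⟨ρ, hρ, rfl⟩
  exact traceDist_le_one (hT.apply_mem_states hρ) (hT.asymptotic.apply_mem_states hρ)

theorem contraction_nonneg (T : SuperOp ι) : 0 ≤ contraction T := by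
  refine Real.sSup_nonneg ?_
  rintro - ⟨ρ, -, rfl⟩
  exact div_nonneg traceNorm_nonneg (by norm_num)

/-- The condition `0 ≤ b` covers dimension 0, where there are no states and the supremum defaults to
0. -/
theorem contraction_le {T : SuperOp ι} {b : ℝ} (hb : 0 ≤ b)
    (h : ∀ ρ ∈ states ι, traceDist (T ρ) (asymptotic T ρ) ≤ b) : contraction T ≤ b := by
  refine Real.sSup_le ?_ hb
  rintro - ⟨ρ, hρ, rfl⟩
  exact h ρ hρ

theorem IsChannel.contraction_le_one {T : SuperOp ι} (hT : IsChannel T) : contraction T ≤ 1 :=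
  contraction_le zero_le_one fun _ hρ =>
    traceDist_le_one (hT.apply_mem_states hρ) (hT.asymptotic.apply_mem_states hρ)

theorem IsChannel.traceDist_le_contraction {T : SuperOp ι} (hT : IsChannel T) {ρ : Matrix ι ι ℂ}
    (hρ : ρ ∈ states ι) : traceDist (T ρ) (QuantumCutoff.asymptotic T ρ) ≤ contraction T :=
  le_csSup hT.bddAbove ⟨ρ, hρ, rfl⟩

end Spectral

/-! ### Tensoring with an identity channel. -/

section Stabilization

variable {ι κ : Type*} [Fintype ι] [DecidableEq ι] [Fintype κ] [DecidableEq κ]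

/-- The `κ`-block of a matrix on `ι × κ` at position `(i, j)`. -/
def block (M : Matrix (ι × κ) (ι × κ) ℂ) (i j : ι) : Matrix κ κ ℂ :=
  Matrix.of fun a b => M (i, a) (j, b)

/-- The inclusion of the `i`-th copy of `ℂ^κ` into `ℂ^(ι × κ)`. -/
def blockEmbed (κ : Type*) [DecidableEq κ] (i : ι) : Matrix (ι × κ) κ ℂ :=
  Matrix.of fun p b => if p = (i, b) then 1 else 0

theorem blockEmbed_conj (M : Matrix (ι × κ) (ι × κ) ℂ) (i j : ι) :
    (blockEmbed κ i)ᴴ * M * blockEmbed κ j = block M i j := by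
  ext a b
  simp [Matrix.mul_apply, blockEmbed, block, apply_ite]

/-- This is the compression of M by z̄ J_i + J_j, where J_i includes the i-th block. -/
theorem posSemidef_block_combination {M : Matrix (ι × κ) (ι × κ) ℂ} (hM : M.PosSemidef) (i j : ι)
    {z : ℂ} (hz : ‖z‖ = 1) :
    (block M i i + block M j j + (z • block M i j + star z • block M j i)).PosSemidef := by
  have h := hM.conjTranspose_mul_mul_same (star z • blockEmbed κ i + blockEmbed κ j)
  have hzz : z * star z = 1 := by
    rw [Complex.star_def, Complex.mul_conj, Complex.normSq_eq_norm_sq, hz]; simp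
  convert h using 1
  simp only [Matrix.conjTranspose_add, Matrix.conjTranspose_smul, star_star, Matrix.add_mul,
    Matrix.mul_add, Matrix.smul_mul, Matrix.mul_smul, blockEmbed_conj, smul_add, smul_smul]
  rw [mul_comm (star z) z, hzz, one_smul]
  abel

/-- With D = M_ii + M_jj and X = z M_ij + z̄ M_ji, both D ± X are positive semidefinite and X = (D +
X)/2 - (D - X)/2. Off-diagonal blocks are thus controlled by the traces of diagonal ones. -/
theorem exists_block_decomposition {M : Matrix (ι × κ) (ι × κ) ℂ} (hM : M.PosSemidef) (i j : ι)
    {z : ℂ} (hz : ‖z‖ = 1) :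
    ∃ A B : Matrix κ κ ℂ, A.PosSemidef ∧ B.PosSemidef ∧
      z • block M i j + star z • block M j i = A - B ∧
      A.trace.re + B.trace.re = (block M i i).trace.re + (block M j j).trace.re := by
  have hp : (0 : ℂ) ≤ 1 / 2 := by norm_num [Complex.le_def]
  have h1 := (posSemidef_block_combination hM i j hz).smul hp
  have h2 := (posSemidef_block_combination hM i j (z := -z) (by simpa using hz)).smul hp
  refine ⟨_, _, h1, h2, ?_, ?_⟩
  · ext a b
    simp only [Matrix.add_apply, Matrix.smul_apply, Matrix.sub_apply, smul_eq_mul, star_neg]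
    ring
  · rw [← Complex.add_re, ← Matrix.trace_add, ← Complex.add_re, ← Matrix.trace_add]
    congr 2
    ext a b
    simp only [Matrix.add_apply, Matrix.smul_apply, smul_eq_mul, star_neg]
    ring

theorem traceNorm_smul_le {X : Matrix ι ι ℂ} (hX : X.IsHermitian) {c : ℝ} (hc : 0 ≤ c) :
    traceNorm ((c : ℂ) • X) ≤ c * traceNorm X := by
  obtain ⟨A, B, hA, hB, rfl, hn⟩ := exists_posSemidef_sub hX
  have hc' : (0 : ℂ) ≤ c := by exact_mod_cast hc
  have h := traceNorm_sub_le (hA.smul hc') (hB.smul hc')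
  rw [← smul_sub] at h
  refine h.trans (le_of_eq ?_)
  rw [← hn, Matrix.trace_smul, Matrix.trace_smul, smul_eq_mul, smul_eq_mul, Complex.re_ofReal_mul,
    Complex.re_ofReal_mul]
  ring

theorem traceNorm_map_le_of_states {Δ : SuperOp ι} {b : ℝ}
    (hherm : ∀ A, A.PosSemidef → (Δ A).IsHermitian)
    (hb : ∀ ρ ∈ states ι, traceNorm (Δ ρ) ≤ b) {A : Matrix ι ι ℂ} (hA : A.PosSemidef) :
    traceNorm (Δ A) ≤ b * A.trace.re := by
  rcases eq_or_ne A.trace.re 0 with h0 | h0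
  · have : A = 0 := hA.trace_eq_zero_iff.mp (by rw [PosSemidef.trace_eq_re hA, h0]; simp)
    simp [this, traceNorm_zero]
  · have hpos : 0 < A.trace.re := lt_of_le_of_ne (PosSemidef.re_trace_nonneg hA) h0.symm
    have hc : (0 : ℂ) ≤ ((A.trace.re)⁻¹ : ℝ) := by exact_mod_cast (inv_pos.mpr hpos).le
    set ρ : Matrix ι ι ℂ := (((A.trace.re)⁻¹ : ℝ) : ℂ) • A with hρ
    have hρs : ρ ∈ states ι := by
      refine ⟨hA.smul hc, ?_⟩
      rw [hρ, Matrix.trace_smul, smul_eq_mul]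
      conv_lhs => rw [PosSemidef.trace_eq_re hA]
      rw [← Complex.ofReal_mul, Complex.ofReal_re, inv_mul_cancel₀ h0, Complex.ofReal_one]
    have hAρ : A = ((A.trace.re : ℝ) : ℂ) • ρ := by
      rw [hρ, smul_smul, ← Complex.ofReal_mul, mul_inv_cancel₀ h0, Complex.ofReal_one, one_smul]
    conv_lhs => rw [hAρ, map_smul]
    refine (traceNorm_smul_le (hherm ρ hρs.1) hpos.le).trans ?_
    rw [mul_comm]
    gcongr
    exact hb ρ hρs

theorem traceNorm_map_sub_le {Δ : SuperOp ι} {b : ℝ}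
    (hherm : ∀ A, A.PosSemidef → (Δ A).IsHermitian)
    (hb : ∀ ρ ∈ states ι, traceNorm (Δ ρ) ≤ b) {A B : Matrix ι ι ℂ} (hA : A.PosSemidef)
    (hB : B.PosSemidef) : traceNorm (Δ (A - B)) ≤ b * (A.trace.re + B.trace.re) := by
  rw [map_sub, mul_add]
  exact (traceNorm_sub_le_add (hherm A hA) (hherm B hB)).trans
    (add_le_add (traceNorm_map_le_of_states hherm hb hA) (traceNorm_map_le_of_states hherm hb hB))

theorem tensorId_apply_eq_sum (Δ : SuperOp ι) (M : Matrix (ι × κ) (ι × κ) ℂ) :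
    tensorId Δ κ M = ∑ i, ∑ j, Δ (Matrix.single i j 1) ⊗ₖ block M i j := by
  have hM : M = ∑ i, ∑ j, Matrix.single i j (1 : ℂ) ⊗ₖ block M i j := by
    ext p q
    simp [Matrix.sum_apply, Matrix.kroneckerMap_apply, Matrix.single_apply, block, ite_and]
  conv_lhs => rw [hM]
  simp only [map_sum, tensorId_kronecker]

/-- Tensoring with an identity channel increases the norm of a Hermiticity-preserving map on states
at most by a factor of twice the dimension. -/
theorem traceNorm_tensorId_le {Δ : SuperOp ι} {b : ℝ} (hb0 : 0 ≤ b)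
    (hherm : ∀ A, A.PosSemidef → (Δ A).IsHermitian)
    (hb : ∀ ρ ∈ states ι, traceNorm (Δ ρ) ≤ b) {M : Matrix (ι × κ) (ι × κ) ℂ}
    (hM : M.PosSemidef) :
    traceNorm (tensorId Δ κ M) ≤ 2 * Fintype.card ι * b * M.trace.re := by
  -- The blocks of the unnormalised maximally entangled projector are the matrix units, so one
  -- decomposition lemma serves both for M and for the arguments of Δ.
  let v : ι × ι → ℂ := fun p => if p.1 = p.2 then 1 else 0
  have hΩ := Matrix.posSemidef_vecMulVec_self_star v
  have hE (i j : ι) : block (Matrix.vecMulVec v (star v)) i j = Matrix.single i j 1 := by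
    ext a b
    by_cases h1 : i = a <;> by_cases h2 : j = b <;>
      simp [block, v, Matrix.vecMulVec_apply, h1, h2]
  let H (z : ℂ) (i j : ι) : Matrix ι ι ℂ :=
    z • Matrix.single i j 1 + star z • Matrix.single j i 1
  let R (z : ℂ) (i j : ι) : Matrix κ κ ℂ := z • block M i j + star z • block M j i
  have hH (z : ℂ) (hz : ‖z‖ = 1) (i j : ι) :
      (Δ (H z i j)).IsHermitian ∧ traceNorm (Δ (H z i j)) ≤ 2 * b := by
    obtain ⟨A, B, hA, hB, h1, h2⟩ := exists_block_decomposition hΩ i j hz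
    simp only [hE] at h1 h2
    have h3 : H z i j = A - B := h1
    rw [h3]
    constructor
    · rw [map_sub]
      exact (hherm A hA).sub (hherm B hB)
    · refine (traceNorm_map_sub_le hherm hb hA hB).trans (le_of_eq ?_)
      rw [h2, Matrix.trace_single_eq_same, Matrix.trace_single_eq_same, Complex.one_re]
      ring
  have hR (z : ℂ) (hz : ‖z‖ = 1) (i j : ι) : (R z i j).IsHermitian ∧
      traceNorm (R z i j) ≤ (block M i i).trace.re + (block M j j).trace.re := by
    obtain ⟨A, B, hA, hB, h1, h2⟩ := exists_block_decomposition hM i j hz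
    have h3 : R z i j = A - B := h1
    rw [h3, ← h2]
    exact ⟨hA.isHermitian.sub hB.isHermitian, traceNorm_sub_le hA hB⟩
  have hK (z : ℂ) (hz : ‖z‖ = 1) (i j : ι) : (Δ (H z i j) ⊗ₖ R z i j).IsHermitian := by
    rw [Matrix.IsHermitian, Matrix.conjTranspose_kronecker, (hH z hz i j).1, (hR z hz i j).1]
  have hKn (z : ℂ) (hz : ‖z‖ = 1) (i j : ι) : traceNorm (Δ (H z i j) ⊗ₖ R z i j) ≤
      2 * b * ((block M i i).trace.re + (block M j j).trace.re) :=
    (traceNorm_kronecker_le (hH z hz i j).1 (hR z hz i j).1).trans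
      (mul_le_mul (hH z hz i j).2 (hR z hz i j).2 traceNorm_nonneg (by positivity))
  have hI : ‖-Complex.I‖ = 1 := by simp
  have h1 : ‖(1 : ℂ)‖ = 1 := by simp
  -- Polarisation: in the difference of the terms for z = 1 and z = -i the mixed products Δ(E_ij) ⊗
  -- M_ji cancel.
  let D (i j : ι) : Matrix (ι × κ) (ι × κ) ℂ :=
    Δ (H 1 i j) ⊗ₖ R 1 i j - Δ (H (-Complex.I) i j) ⊗ₖ R (-Complex.I) i j
  have hD (i j : ι) : (D i j).IsHermitian := (hK 1 h1 i j).sub (hK _ hI i j)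
  have hDn (i j : ι) : traceNorm (D i j) ≤
      4 * b * ((block M i i).trace.re + (block M j j).trace.re) := by
    refine (traceNorm_sub_le_add (hK 1 h1 i j) (hK _ hI i j)).trans ?_
    linarith [hKn 1 h1 i j, hKn _ hI i j]
  have hDe (i j : ι) : D i j = (2 : ℂ) • (Δ (Matrix.single i j 1) ⊗ₖ block M i j)
      + (2 : ℂ) • (Δ (Matrix.single j i 1) ⊗ₖ block M j i) := by
    ext p q
    simp only [D, H, R, map_add, map_smul, Matrix.sub_apply, Matrix.kroneckerMap_apply,
      Matrix.add_apply, Matrix.smul_apply, smul_eq_mul, Complex.star_def, map_one, map_neg,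
      Complex.conj_I]
    linear_combination (-(Δ (Matrix.single i j 1) p.1 q.1 - Δ (Matrix.single j i 1) p.1 q.1) *
      (block M i j p.2 q.2 - block M j i p.2 q.2)) * Complex.I_sq
  -- Each Δ(E_ij) ⊗ M_ij occurs with weight 2 in `D i j` and again in `D j i`, hence the factor 1/4.
  have hsum : tensorId Δ κ M = ((1 / 4 : ℝ) : ℂ) • ∑ i, ∑ j, D i j := by
    simp only [hDe, Finset.sum_add_distrib, ← Finset.smul_sum]
    rw [Finset.sum_comm (f := fun i j => Δ (Matrix.single j i 1) ⊗ₖ block M j i),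
      ← tensorId_apply_eq_sum, ← add_smul, smul_smul]
    norm_num
  have htr : M.trace.re = ∑ i, (block M i i).trace.re := by
    simp [Matrix.trace, Fintype.sum_prod_type, block]
  rw [hsum]
  refine (traceNorm_smul_le (isHermitian_sum _ fun i _ => isHermitian_sum _ fun j _ => hD i j)
    (by norm_num)).trans ?_
  have h5 : traceNorm (∑ i, ∑ j, D i j) ≤
      ∑ i, ∑ j, 4 * b * ((block M i i).trace.re + (block M j j).trace.re) :=
    (traceNorm_sum_le _ fun i _ => isHermitian_sum _ fun j _ => hD i j).trans
      (Finset.sum_le_sum fun i _ => (traceNorm_sum_le _ fun j _ => hD i j).trans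
        (Finset.sum_le_sum fun j _ => hDn i j))
  have h6 : ∑ i, ∑ j, 4 * b * ((block M i i).trace.re + (block M j j).trace.re)
      = 8 * Fintype.card ι * b * M.trace.re := by
    simp only [← Finset.mul_sum, Finset.sum_add_distrib, ← htr, Finset.sum_const,
      Finset.card_univ, nsmul_eq_mul]
    ring
  linarith

/-- The factor 2 between trace norm and trace distance enters on both sides and cancels, which
leaves 2d, half of the constant in the theorem. -/
theorem IsChannel.contraction_tensorId_le {T : SuperOp ι} (hT : IsChannel T) :
    contraction (QuantumCutoff.tensorId T κ) ≤ 2 * Fintype.card ι * contraction T := by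
  have h0 := contraction_nonneg T
  refine contraction_le (by positivity) fun ρ hρ => ?_
  rw [hT.asymptotic_tensorId, traceDist, ← LinearMap.sub_apply, ← tensorId_sub]
  have h := traceNorm_tensorId_le (κ := κ) (Δ := T - QuantumCutoff.asymptotic T)
    (b := 2 * contraction T) (by positivity)
    (fun A hA => (hT.posSemidef hA).isHermitian.sub (hT.asymptotic.posSemidef hA).isHermitian)
    (fun σ hσ => by
      have := hT.traceDist_le_contraction hσ
      rw [traceDist] at this
      rw [LinearMap.sub_apply]
      linarith) hρ.1
  rw [hρ.2, Complex.one_re] at h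
  linarith

end Stabilization

/-! ### The exponential of a generator. -/

section Evolution

variable {ι : Type*} [Fintype ι] [DecidableEq ι]

attribute [local instance] Matrix.linftyOpNormedRing Matrix.linftyOpNormedAlgebra in
theorem hasSum_matrix_exp {m : Type*} [Fintype m] [DecidableEq m] (A : Matrix m m ℂ) :
    HasSum (fun k : ℕ => ((k.factorial : ℂ)⁻¹) • A ^ k) (NormedSpace.exp A) :=
  NormedSpace.exp_series_hasSum_exp' A

attribute [local instance] Matrix.linftyOpNormedRing Matrix.linftyOpNormedAlgebra in
theorem continuous_matrix_exp {m : Type*} [Fintype m] [DecidableEq m] :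
    Continuous (NormedSpace.exp : Matrix m m ℂ → Matrix m m ℂ) :=
  NormedSpace.exp_continuous

/-- Evaluation at `X` of the superoperator with a given matrix. -/
def evalToLin (X : Matrix ι ι ℂ) : Matrix (ι × ι) (ι × ι) ℂ →ₗ[ℂ] Matrix ι ι ℂ :=
  LinearMap.applyₗ X ∘ₗ
    (Matrix.toLin (Matrix.stdBasis ℂ ι ι) (Matrix.stdBasis ℂ ι ι)).toLinearMap

theorem continuous_evalToLin (X : Matrix ι ι ℂ) : Continuous (evalToLin X) :=
  LinearMap.continuous_of_finiteDimensional _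

theorem evolution_apply (L : SuperOp ι) (t : ℝ) (X : Matrix ι ι ℂ) :
    evolution L t X = evalToLin X (NormedSpace.exp ((t : ℂ) •
      LinearMap.toMatrix (Matrix.stdBasis ℂ ι ι) (Matrix.stdBasis ℂ ι ι) L)) := by
  rw [evolution, evalToLin, LinearMap.comp_apply, LinearMap.applyₗ_apply_apply,
    LinearEquiv.coe_coe]

/-- A series free of matrix coordinates, from which the action on eigenvectors and left eigenvectors
is read off term by term. -/
theorem hasSum_evolution (L : SuperOp ι) (t : ℝ) (X : Matrix ι ι ℂ) :
    HasSum (fun k : ℕ => (((k.factorial : ℂ)⁻¹) * (t : ℂ) ^ k) • (L ^ k) X) (evolution L t X) := by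
  have h := (hasSum_matrix_exp ((t : ℂ) • LinearMap.toMatrix (Matrix.stdBasis ℂ ι ι)
    (Matrix.stdBasis ℂ ι ι) L)).map (evalToLin X) (continuous_evalToLin X)
  rw [evolution_apply]
  refine h.congr_fun fun k => ?_
  simp only [Function.comp_apply, smul_pow, map_smul, smul_smul]
  congr 1
  simp [evalToLin, LinearMap.toMatrix_pow]

theorem evolution_zero (L : SuperOp ι) : evolution L 0 = 1 := by
  simp [evolution]
  rfl

theorem evolution_add (L : SuperOp ι) (s t : ℝ) :
    evolution L (s + t) = evolution L s * evolution L t := by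
  rw [evolution, Complex.ofReal_add, add_smul, Matrix.exp_add_of_commute, Module.End.mul_eq_comp,
    Matrix.toLin_mul _ (Matrix.stdBasis ℂ ι ι)]
  · rfl
  · exact ((Commute.refl _).smul_left _).smul_right _

theorem evolution_natCast_mul (L : SuperOp ι) (t : ℝ) (k : ℕ) :
    evolution L (k * t) = evolution L t ^ k := by
  induction k with
  | zero => simp [evolution_zero]
  | succ k ih => rw [Nat.cast_succ, add_mul, one_mul, evolution_add, ih, pow_succ]

theorem continuous_evolution (L : SuperOp ι) (X : Matrix ι ι ℂ) :
    Continuous fun t => evolution L t X := by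
  simp only [evolution_apply]
  have h : Continuous fun t : ℝ => (t : ℂ) • LinearMap.toMatrix (Matrix.stdBasis ℂ ι ι)
      (Matrix.stdBasis ℂ ι ι) L := by fun_prop
  exact (continuous_evalToLin X).comp (continuous_matrix_exp.comp h)

theorem hasSum_complex_exp (z : ℂ) :
    HasSum (fun k : ℕ => ((k.factorial : ℂ)⁻¹) * z ^ k) (Complex.exp z) := by
  have h := NormedSpace.exp_series_hasSum_exp' (𝕂 := ℂ) z
  rw [← Complex.exp_eq_exp_ℂ] at h
  exact h

theorem evolution_eigen {L : SuperOp ι} {z : ℂ} {v : Matrix ι ι ℂ} (h : L v = z • v) (t : ℝ) :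
    evolution L t v = Complex.exp (t * z) • v := by
  refine (hasSum_evolution L t v).unique ?_
  refine ((hasSum_complex_exp (t * z)).smul_const v).congr_fun ?_
  intro k
  rw [pow_apply_of_eigen h, smul_smul, mul_pow, mul_assoc]

theorem evolution_left_eigen {L : SuperOp ι} {z : ℂ} {f : Matrix ι ι ℂ →ₗ[ℂ] ℂ}
    (h : ∀ X, f (L X) = z * f X) (t : ℝ) (X : Matrix ι ι ℂ) :
    f (evolution L t X) = Complex.exp (t * z) * f X := by
  have hk (k : ℕ) (X : Matrix ι ι ℂ) : f ((L ^ k) X) = z ^ k * f X := by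
    induction k generalizing X with
    | zero => simp
    | succ k ih => rw [pow_succ, Module.End.mul_apply, ih, h, pow_succ]; ring
  have h1 := (hasSum_evolution L t X).map f (LinearMap.continuous_of_finiteDimensional f)
  refine h1.unique (((hasSum_complex_exp (t * z)).mul_right (f X)).congr_fun ?_)
  intro k
  simp only [Function.comp_apply, map_smul, smul_eq_mul, hk, mul_pow]
  ring

theorem evolution_commute (L : SuperOp ι) (t : ℝ) (X : Matrix ι ι ℂ) :
    L (evolution L t X) = evolution L t (L X) := by
  have h1 := (hasSum_evolution L t X).map L (LinearMap.continuous_of_finiteDimensional L)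
  refine h1.unique ((hasSum_evolution L t (L X)).congr_fun ?_)
  intro k
  simp only [Function.comp_apply, map_smul]
  rw [← Module.End.mul_apply, ← Module.End.mul_apply, ← pow_succ, ← pow_succ']

/-- Eigenvalues of `e^L` are exponentials of eigenvalues of `L`. -/
theorem exists_eigenvalue_of_evolution_one {L : SuperOp ι} {ν : ℂ}
    (hν : (evolution L 1).HasEigenvalue ν) : ∃ z ∈ spectrum ℂ L, ν = Complex.exp z := by
  -- L commutes with e^L, so it preserves the eigenspace and has an eigenvector inside it.
  have hmaps : Set.MapsTo L ((evolution L 1).eigenspace ν) ((evolution L 1).eigenspace ν) := by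
    intro X hX
    have hX' := Module.End.mem_eigenspace_iff.mp hX
    refine Module.End.mem_eigenspace_iff.mpr ?_
    rw [← evolution_commute, hX', map_smul]
  have : Nontrivial ((evolution L 1).eigenspace ν) := Submodule.nontrivial_iff_ne_bot.mpr hν
  obtain ⟨z, hz⟩ := Module.End.exists_eigenvalue (L.restrict hmaps)
  obtain ⟨v, hv⟩ := hz.exists_hasEigenvector
  have hv0 : (v : Matrix ι ι ℂ) ≠ 0 := fun h => hv.2 (Subtype.ext h)
  have h1 : L v = z • (v : Matrix ι ι ℂ) := congrArg Subtype.val hv.apply_eq_smul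
  refine ⟨z, Module.End.hasEigenvalue_iff_mem_spectrum.mp
    (Module.End.hasEigenvalue_of_hasEigenvector (Module.End.hasEigenvector_iff.mpr
      ⟨Module.End.mem_eigenspace_iff.mpr h1, hv0⟩)), ?_⟩
  have h2 := Module.End.mem_eigenspace_iff.mp v.2
  rw [evolution_eigen h1, Complex.ofReal_one, one_mul] at h2
  exact (smul_left_injective ℂ hv0 h2).symm

theorem IsLiouvillian.isChannelSemigroup_tensorPower {L : SuperOp ι} (hL : IsLiouvillian L)
    (n : ℕ) : IsChannelSemigroup fun t => tensorPower n (evolution L t) where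
  channel t ht := (hL t ht).tensorPower
  zero := by rw [evolution_zero]; exact tensorMap_one
  add s t _ _ := by rw [evolution_add, tensorPower_mul]
  continuousOn X t _ := by
    refine Tendsto.mono_left ?_ nhdsWithin_le_nhds
    exact tendsto_tensorPower (fun Y => (continuous_evolution L Y).tendsto t) X

end Evolution

/-! ### Exponential convergence governed by the spectral gap. -/

section Gap

variable {ι : Type*} [Fintype ι] [DecidableEq ι]

theorem finite_gap_set (L : SuperOp ι) :
    ((fun z : ℂ => |z.re|) '' {z | z ∈ spectrum ℂ L ∧ z.re < 0}).Finite :=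
  ((Module.End.finite_spectrum L).subset fun _ h => h.1).image _

theorem gap_le {L : SuperOp ι} {z : ℂ} (hz : z ∈ spectrum ℂ L) (h : z.re < 0) : gap L ≤ -z.re := by
  rw [← abs_of_neg h]
  exact csInf_le (finite_gap_set L).bddBelow ⟨z, ⟨hz, h⟩, rfl⟩

theorem exists_re_eq_neg_gap {L : SuperOp ι} (h : ∃ z ∈ spectrum ℂ L, z.re < 0) :
    ∃ z ∈ spectrum ℂ L, z.re = -gap L ∧ 0 < gap L := by
  obtain ⟨z₀, h₀, h₁⟩ := h
  obtain ⟨z, ⟨hz, hz0⟩, he⟩ :=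
    Set.Nonempty.csInf_mem (s := (fun z : ℂ => |z.re|) '' {z | z ∈ spectrum ℂ L ∧ z.re < 0})
      ⟨_, z₀, ⟨h₀, h₁⟩, rfl⟩ (finite_gap_set L)
  have he' : |z.re| = gap L := he
  rw [abs_of_neg hz0] at he'
  exact ⟨z, hz, by linarith, by linarith⟩

/-- The entries of the images under channels are bounded uniformly in the channel. -/
theorem exists_channel_apply_bound (ι : Type*) [Fintype ι] [DecidableEq ι] :
    ∃ C : ℝ, 0 ≤ C ∧ ∀ T : SuperOp ι, IsChannel T → ∀ X i j,
      ‖T X i j‖ ≤ C * ∑ a, ∑ b, ‖X a b‖ := by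
  have hunit (p : ι × ι) : ∃ C : ℝ, 0 ≤ C ∧ ∀ T : SuperOp ι, IsChannel T → ∀ i j,
      ‖T (Matrix.single p.1 p.2 1) i j‖ ≤ C := by
    obtain ⟨A, B, C, D, hA, hB, hC, hD, hX⟩ :=
      exists_posSemidef_combination (Matrix.single p.1 p.2 (1 : ℂ))
    have h0 {Y : Matrix ι ι ℂ} (hY : Y.PosSemidef) := PosSemidef.re_trace_nonneg hY
    refine ⟨A.trace.re + B.trace.re + (C.trace.re + D.trace.re),
      add_nonneg (add_nonneg (h0 hA) (h0 hB)) (add_nonneg (h0 hC) (h0 hD)), fun T hT i j => ?_⟩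
    have h {Y : Matrix ι ι ℂ} (hY : Y.PosSemidef) : ‖T Y i j‖ ≤ Y.trace.re := by
      rw [← hT.trace_map]
      exact norm_apply_le_trace (hT.posSemidef hY) i j
    rw [hX]
    simp only [map_add, map_sub, map_smul, Matrix.add_apply, Matrix.sub_apply, Matrix.smul_apply]
    refine (norm_add_le _ _).trans (add_le_add ?_ ?_)
    · exact (norm_sub_le _ _).trans (add_le_add (h hA) (h hB))
    · rw [norm_smul, Complex.norm_I, one_mul]
      exact (norm_sub_le _ _).trans (add_le_add (h hC) (h hD))
  choose c hc0 hc using hunit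
  refine ⟨∑ p, c p, Finset.sum_nonneg fun p _ => hc0 p, fun T hT X i j => ?_⟩
  have hX : X = ∑ a, ∑ b, X a b • Matrix.single a b (1 : ℂ) := by
    conv_lhs => rw [Matrix.matrix_eq_sum_single X]
    simp
  conv_lhs => rw [hX]
  simp only [map_sum, map_smul, Matrix.sum_apply, Matrix.smul_apply, smul_eq_mul, Finset.mul_sum]
  refine (norm_sum_le _ _).trans (Finset.sum_le_sum fun a _ => (norm_sum_le _ _).trans
    (Finset.sum_le_sum fun b _ => ?_))
  rw [norm_mul, mul_comm]
  gcongr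
  exact (hc (a, b) T hT i j).trans
    (Finset.single_le_sum (f := c) (fun p _ => hc0 p) (Finset.mem_univ (a, b)))

/-- Split s into ⌊s/t⌋ steps of length t and a remainder; the evolution over the remainder is a
channel, so its size is bounded uniformly. This transfers decay from integer powers to real times.
-/
theorem IsLiouvillian.exists_norm_evolution_le {L : SuperOp ι} (hL : IsLiouvillian L) :
    ∃ C : ℝ, 0 ≤ C ∧ ∀ s t : ℝ, 0 < t → 0 ≤ s → ∀ X i j,
      ‖evolution L s X i j‖ ≤ C * ∑ a, ∑ b, ‖(evolution L t ^ ⌊s / t⌋₊) X a b‖ := by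
  obtain ⟨C, hC, h⟩ := exists_channel_apply_bound ι
  refine ⟨C, hC, fun s t ht hs X i j => ?_⟩
  have h1 : (⌊s / t⌋₊ : ℝ) * t ≤ s := by
    rw [← le_div_iff₀ ht]; exact Nat.floor_le (by positivity)
  have h2 := h (evolution L (s - ⌊s / t⌋₊ * t)) (hL _ (by linarith))
    ((evolution L t ^ ⌊s / t⌋₊) X) i j
  rw [← evolution_natCast_mul, ← Module.End.mul_apply, ← evolution_add, sub_add_cancel] at h2
  rwa [← evolution_natCast_mul]

theorem IsLiouvillian.tendsto_zero {L : SuperOp ι} (hL : IsLiouvillian L) {t : ℝ} (ht : 0 < t)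
    (X : Matrix ι ι ℂ) :
    Tendsto (fun s => evolution L s ((1 - peripheralProj (evolution L t)) X)) atTop (𝓝 0) := by
  obtain ⟨C, hC, h⟩ := hL.exists_norm_evolution_le
  rw [tendsto_matrix_iff]
  intro i j
  have h0 := tendsto_matrix_iff.mp ((hL t ht.le).powerBounded.tendsto_zero X)
  have hfl : Tendsto (fun s : ℝ => ⌊s / t⌋₊) atTop atTop :=
    tendsto_nat_floor_atTop.comp (tendsto_id.atTop_div_const ht)
  have h1 : Tendsto (fun s : ℝ => C * ∑ a, ∑ b, ‖(evolution L t ^ ⌊s / t⌋₊)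
      ((1 - peripheralProj (evolution L t)) X) a b‖) atTop (𝓝 0) := by
    have : Tendsto (fun k : ℕ => C * ∑ a, ∑ b, ‖(evolution L t ^ k)
        ((1 - peripheralProj (evolution L t)) X) a b‖) atTop (𝓝 (C * ∑ _a : ι, ∑ _b : ι, 0)) := by
      refine Tendsto.const_mul C (tendsto_finsetSum _ fun a _ => tendsto_finsetSum _ fun b _ => ?_)
      simpa using (h0 a b).norm
    simp only [Finset.sum_const_zero, mul_zero] at this
    exact this.comp hfl
  refine squeeze_zero_norm' ?_ h1
  filter_upwards [eventually_ge_atTop 0] with s hs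
  exact h s t ht hs _ i j

/-- The projection at s is a limit of evolutions at times ks → ∞, and late evolutions annihilate the
range of 1 - P_t. -/
theorem IsLiouvillian.peripheralProj_mul {L : SuperOp ι} (hL : IsLiouvillian L) {s t : ℝ}
    (hs : 0 < s) (ht : 0 < t) (X : Matrix ι ι ℂ) :
    peripheralProj (evolution L s) ((1 - peripheralProj (evolution L t)) X) = 0 := by
  obtain ⟨F, _, hF, h⟩ := (hL s hs.le).powerBounded.exists_tendsto_peripheralProj
  refine tendsto_nhds_unique (h _) ?_
  have h1 : Tendsto (fun k : ℕ => (k : ℝ) * s) F atTop :=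
    (tendsto_natCast_atTop_atTop.atTop_mul_const hs).mono_left hF
  refine ((hL.tendsto_zero ht X).comp h1).congr fun k => ?_
  simp [evolution_natCast_mul]

/-- The peripheral projection of `e^{tL}` does not depend on `t > 0`. -/
theorem IsLiouvillian.peripheralProj_eq {L : SuperOp ι} (hL : IsLiouvillian L) {s t : ℝ}
    (hs : 0 < s) (ht : 0 < t) :
    peripheralProj (evolution L s) = peripheralProj (evolution L t) := by
  have hcont (S : SuperOp ι) : Continuous S := LinearMap.continuous_of_finiteDimensional S
  obtain ⟨F, _, hF, hFs⟩ := (hL s hs.le).powerBounded.exists_tendsto_peripheralProj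
  obtain ⟨G, _, hG, hGt⟩ := (hL t ht.le).powerBounded.exists_tendsto_peripheralProj
  have hc (k l : ℕ) (X : Matrix ι ι ℂ) : (evolution L s ^ k) ((evolution L t ^ l) X)
      = (evolution L t ^ l) ((evolution L s ^ k) X) := by
    simp only [← evolution_natCast_mul, ← Module.End.mul_apply, ← evolution_add]
    rw [add_comm]
  have hc1 (k : ℕ) (X : Matrix ι ι ℂ) :
      (evolution L s ^ k) (peripheralProj (evolution L t) X)
        = peripheralProj (evolution L t) ((evolution L s ^ k) X) := by
    refine tendsto_nhds_unique (((hcont _).tendsto _).comp (hGt X)) ?_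
    exact (hGt ((evolution L s ^ k) X)).congr fun l => (hc k l X).symm
  have hc2 (X : Matrix ι ι ℂ) :
      peripheralProj (evolution L s) (peripheralProj (evolution L t) X)
        = peripheralProj (evolution L t) (peripheralProj (evolution L s) X) := by
    refine tendsto_nhds_unique (hFs _) ?_
    exact (((hcont _).tendsto _).comp (hFs X)).congr fun k => (hc1 k X).symm
  refine LinearMap.ext fun X => ?_
  -- P_s = P_s P_t and P_t = P_t P_s; since the projections commute, they agree.
  have h1 := hL.peripheralProj_mul hs ht X
  have h2 := hL.peripheralProj_mul ht hs X
  rw [LinearMap.sub_apply, Module.End.one_apply, map_sub, sub_eq_zero] at h1 h2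
  rw [h1, hc2, ← h2]

theorem sum_norm_le_of_mem_states {ρ : Matrix ι ι ℂ} (hρ : ρ ∈ states ι) :
    ∑ a, ∑ b, ‖ρ a b‖ ≤ (Fintype.card ι : ℝ) ^ 2 := by
  have h (a b : ι) : ‖ρ a b‖ ≤ 1 := by
    have := norm_apply_le_trace hρ.1 a b
    rwa [hρ.2, Complex.one_re] at this
  refine (Finset.sum_le_sum fun a _ => Finset.sum_le_sum fun b _ => h a b).trans (le_of_eq ?_)
  simp [sq]

/-- Exponential convergence to the asymptotic evolution at any rate below the gap. -/
theorem IsLiouvillian.exists_traceNorm_le {L : SuperOp ι} (hL : IsLiouvillian L) {g : ℝ}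
    (hg : g < gap L) :
    ∃ C : ℝ, 0 ≤ C ∧ ∀ t : ℝ, 1 ≤ t → 0 ≤ g → ∀ ρ ∈ states ι,
      traceNorm ((evolution L t - asymptotic (evolution L t)) ρ) ≤ C * Real.exp (-(g * t)) := by
  obtain ⟨C₁, hC₁, h₁⟩ := hL.exists_norm_evolution_le
  -- An eigenvalue of e^L inside the open disc is e^z with Re z ≤ -gap < -g.
  obtain ⟨C₂, hC₂, h₂⟩ := (hL 1 zero_le_one).powerBounded.exists_norm_le (Real.exp_pos (-g))
    fun ν hν hν1 => by
      obtain ⟨z, hz, rfl⟩ := exists_eigenvalue_of_evolution_one hν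
      rw [Complex.norm_exp] at hν1 ⊢
      have h0 : z.re < 0 := Real.exp_lt_one_iff.mp hν1
      exact Real.exp_lt_exp.mpr (by linarith [gap_le hz h0])
  set d : ℝ := (Fintype.card ι : ℝ) with hd
  refine ⟨d * (d ^ 2 * (C₁ * (d ^ 2 * (C₂ * Real.exp g * d ^ 2)))), by positivity,
    fun t ht hg0 ρ hρ => ?_⟩
  have ht0 : 0 < t := by linarith
  have hT := hL t ht0.le
  have e : evolution L t - asymptotic (evolution L t)
      = evolution L t * (1 - peripheralProj (evolution L 1)) := by
    rw [hT.powerBounded.asymptotic_eq, hL.peripheralProj_eq ht0 one_pos, mul_sub, mul_one]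
  have hherm : ((evolution L t - asymptotic (evolution L t)) ρ).IsHermitian :=
    (hT.posSemidef hρ.1).isHermitian.sub (hT.asymptotic.posSemidef hρ.1).isHermitian
  refine (traceNorm_le_sum_norm hherm).trans ?_
  rw [e, mul_assoc]
  gcongr
  have hsum {f : ι → ι → ℝ} {b : ℝ} (h : ∀ i j, f i j ≤ b) : ∑ i, ∑ j, f i j ≤ d ^ 2 * b := by
    refine (Finset.sum_le_sum fun i _ => Finset.sum_le_sum fun j _ => h i j).trans (le_of_eq ?_)
    simp [sq, mul_assoc, hd]
  rw [mul_assoc]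
  refine hsum fun i j => ?_
  refine (h₁ t 1 one_pos ht0.le _ i j).trans ?_
  rw [mul_assoc]
  gcongr
  rw [mul_assoc]
  refine hsum fun a b => ?_
  -- The decay bound starts at exponent 1, which is why t ≥ 1 is assumed.
  obtain ⟨k, hk⟩ : ∃ k, ⌊t / 1⌋₊ = k + 1 :=
    Nat.exists_eq_succ_of_ne_zero (by rw [div_one]; exact (Nat.floor_pos.mpr ht).ne')
  rw [hk]
  refine (h₂ k ρ a b).trans ?_
  have h3 := sum_norm_le_of_mem_states hρ
  -- Rounding t down to an integer costs at most a factor e^g.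
  have h4 : Real.exp (-g) ^ (k + 1) ≤ Real.exp g * Real.exp (-(g * t)) := by
    rw [← Real.exp_nat_mul, ← Real.exp_add, Real.exp_le_exp]
    have h5 : t < ⌊t / 1⌋₊ + 1 := by rw [div_one]; exact Nat.lt_floor_add_one t
    rw [hk] at h5
    nlinarith
  calc C₂ * Real.exp (-g) ^ (k + 1) * ∑ a, ∑ b, ‖ρ a b‖
      ≤ C₂ * (Real.exp g * Real.exp (-(g * t))) * d ^ 2 := by gcongr
    _ = _ := by ring

end Gap

/-! ### Upper bound: replacing the factors one at a time. -/

section Telescoping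

variable {ι : Type*} [Fintype ι] [DecidableEq ι] {n : ℕ}

theorem pureTensor_sub_pureTensor (k : Fin n) {X Y Z : Fin n → Matrix ι ι ℂ}
    (hk : X k - Y k = Z k) (hX : ∀ j, j ≠ k → X j = Z j) (hY : ∀ j, j ≠ k → Y j = Z j) :
    pureTensor X - pureTensor Y = pureTensor Z := by
  ext a b
  simp only [Matrix.sub_apply, pureTensor, Matrix.of_apply]
  rw [Fintype.prod_eq_mul_prod_subtype_ne _ k,
    Fintype.prod_eq_mul_prod_subtype_ne (fun i => Y i (a i) (b i)) k,
    Fintype.prod_eq_mul_prod_subtype_ne (fun i => Z i (a i) (b i)) k, ← hk,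
    Matrix.sub_apply, sub_mul]
  congr 2
  · exact Finset.prod_congr rfl fun j _ => by rw [hX j j.2]
  · exact Finset.prod_congr rfl fun j _ => by rw [hY j j.2]

theorem tensorMap_sub_tensorMap (k : Fin n) {S T R : Fin n → SuperOp ι}
    (hk : S k - T k = R k) (hS : ∀ j, j ≠ k → S j = R j) (hT : ∀ j, j ≠ k → T j = R j) :
    tensorMap S - tensorMap T = tensorMap R :=
  linearMap_ext_pureTensor fun X => by
    rw [LinearMap.sub_apply, tensorMap_pureTensor, tensorMap_pureTensor, tensorMap_pureTensor]
    exact pureTensor_sub_pureTensor k (by rw [← hk]; rfl) (fun j hj => by rw [hS j hj])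
      fun j hj => by rw [hT j hj]

/-- The superoperator that acts as `Δ` on the tensor factor `k` and trivially on the others. -/
def localMap (k : Fin n) (Δ : SuperOp ι) : SuperOp (Fin n → ι) :=
  tensorMap fun i => if i = k then Δ else 1

/-- Moving the factor k to the front turns the local map into Δ ⊗ id, so that the stabilisation
bound applies. -/
theorem localMap_apply (k : Fin n) (Δ : SuperOp ι) (M : Matrix (Fin n → ι) (Fin n → ι) ℂ) :
    localMap k Δ M = (tensorId Δ ({j // j ≠ k} → ι) (M.submatrix (Equiv.funSplitAt k ι).symm
      (Equiv.funSplitAt k ι).symm)).submatrix (Equiv.funSplitAt k ι) (Equiv.funSplitAt k ι) := by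
  let e := Equiv.funSplitAt k ι
  let S : SuperOp (Fin n → ι) := (Matrix.reindexLinearEquiv ℂ ℂ e.symm e.symm).toLinearMap ∘ₗ
    tensorId Δ ({j // j ≠ k} → ι) ∘ₗ (Matrix.reindexLinearEquiv ℂ ℂ e e).toLinearMap
  suffices h : localMap k Δ = S from LinearMap.congr_fun h M
  refine linearMap_ext_pureTensor fun X => ?_
  have h1 : (pureTensor X).submatrix e.symm e.symm = X k ⊗ₖ
      (Matrix.of fun f g : {j // j ≠ k} → ι => ∏ j : {j // j ≠ k}, X j (f j) (g j)) := by
    ext p q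
    simp only [Matrix.submatrix_apply, pureTensor, Matrix.of_apply, Matrix.kroneckerMap_apply]
    rw [Fintype.prod_eq_mul_prod_subtype_ne _ k]
    congr 1
    · simp [e, Equiv.funSplitAt]
    · refine Finset.prod_congr rfl fun j _ => ?_
      simp [e, Equiv.funSplitAt, j.2]
  change localMap k Δ (pureTensor X) =
    (tensorId Δ ({j // j ≠ k} → ι) ((pureTensor X).submatrix e.symm e.symm)).submatrix e e
  rw [h1, tensorId_kronecker, localMap, tensorMap_pureTensor]
  ext a b
  simp only [Matrix.submatrix_apply, pureTensor, Matrix.of_apply, Matrix.kroneckerMap_apply]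
  rw [Fintype.prod_eq_mul_prod_subtype_ne _ k]
  congr 1
  · simp [e, Equiv.funSplitAt]
  · refine Finset.prod_congr rfl fun j _ => ?_
    simp [e, Equiv.funSplitAt, j.2]

theorem isHermitian_tensorId {κ : Type*} [Fintype κ] [DecidableEq κ] {S T : SuperOp ι}
    (hS : IsChannel S) (hT : IsChannel T) {M : Matrix (ι × κ) (ι × κ) ℂ} (hM : M.PosSemidef) :
    (tensorId (S - T) κ M).IsHermitian := by
  rw [tensorId_sub]
  exact (hS.posSemidef_tensorId hM).isHermitian.sub (hT.posSemidef_tensorId hM).isHermitian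

theorem traceNorm_localMap_le {S T : SuperOp ι} (hS : IsChannel S) (hT : IsChannel T) {b : ℝ}
    (hb0 : 0 ≤ b) (hb : ∀ ρ ∈ states ι, traceNorm ((S - T) ρ) ≤ b) (k : Fin n)
    {M : Matrix (Fin n → ι) (Fin n → ι) ℂ} (hM : M.PosSemidef) :
    (localMap k (S - T) M).IsHermitian ∧
      traceNorm (localMap k (S - T) M) ≤ 2 * Fintype.card ι * b * M.trace.re := by
  have hM' := hM.submatrix (Equiv.funSplitAt k ι).symm
  have hH := isHermitian_tensorId hS hT hM'
  have htr : (M.submatrix (Equiv.funSplitAt k ι).symm (Equiv.funSplitAt k ι).symm).trace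
      = M.trace := by
    simp only [Matrix.trace, Matrix.diag_apply, Matrix.submatrix_apply]
    exact Fintype.sum_equiv (Equiv.funSplitAt k ι).symm _ _ fun x => rfl
  rw [localMap_apply]
  refine ⟨hH.submatrix _, (traceNorm_submatrix_le _ hH).trans ?_⟩
  rw [← htr]
  exact traceNorm_tensorId_le hb0
    (fun A hA => (hS.posSemidef hA).isHermitian.sub (hT.posSemidef hA).isHermitian) hb hM'

/-- The tensor powers of two channels that are close are close, with a linear loss in `n`. -/
theorem traceNorm_tensorPower_sub_le {S T : SuperOp ι} (hS : IsChannel S) (hT : IsChannel T)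
    {b : ℝ} (hb0 : 0 ≤ b) (hb : ∀ ρ ∈ states ι, traceNorm ((S - T) ρ) ≤ b)
    {M : Matrix (Fin n → ι) (Fin n → ι) ℂ} (hM : M.PosSemidef) :
    traceNorm ((tensorPower n S - tensorPower n T) M)
      ≤ n * (2 * Fintype.card ι * b * M.trace.re) := by
  -- The hybrid `H m` has S on the first m factors and T on the rest. Consecutive hybrids differ by
  -- a local S - T followed by the channel `W k`, which does not increase the trace norm.
  let H (m : ℕ) : SuperOp (Fin n → ι) := tensorMap fun i => if (i : ℕ) < m then S else T
  let W (k : Fin n) : SuperOp (Fin n → ι) :=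
    tensorMap fun i => if i = k then 1 else if (i : ℕ) < k then S else T
  have hW (k : Fin n) : IsChannel (W k) := isChannel_tensorMap fun i => by
    split_ifs
    exacts [IsChannel.one, hS, hT]
  have hstep (k : Fin n) : H (k + 1) - H k = W k * localMap k (S - T) := by
    simp only [W, localMap, ← tensorMap_mul]
    refine tensorMap_sub_tensorMap k (by simp) (fun j hj => ?_) fun j hj => ?_
    · have h : ((j : ℕ) < k + 1) ↔ (j : ℕ) < k := by
        have := Fin.val_ne_of_ne hj
        omega
      simp [hj, h]
    · simp [hj]
  have hH0 : H 0 = tensorPower n T := by simp [H, tensorPower_eq_tensorMap]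
  have hHn : H n = tensorPower n S := by simp [H, tensorPower_eq_tensorMap]
  have htel : tensorPower n S - tensorPower n T = ∑ k : Fin n, W k * localMap k (S - T) := by
    rw [← hH0, ← hHn, ← Finset.sum_range_sub, ← Fin.sum_univ_eq_sum_range fun k => H (k + 1) - H k]
    exact Finset.sum_congr rfl fun k _ => hstep k
  have hl (k : Fin n) := traceNorm_localMap_le hS hT hb0 hb k hM
  rw [htel, LinearMap.sum_apply]
  refine (traceNorm_sum_le _ fun k _ => (hW k).isHermitian (hl k).1).trans ?_
  refine (Finset.sum_le_sum fun k _ => ((hW k).traceNorm_le (hl k).1).trans (hl k).2).trans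
    (le_of_eq ?_)
  simp

theorem IsLiouvillian.tendsto_contraction_zero {L : SuperOp ι} (hL : IsLiouvillian L)
    (hgap : 0 < gap L) {c : ℝ} (hc : 1 < c) :
    Tendsto (fun n : ℕ => contraction (tensorPower n (evolution L (c * (Real.log n / gap L)))))
      atTop (𝓝 0) := by
  -- The slack c > 1 pays for a rate strictly below the gap; at the gap itself Jordan blocks could
  -- add polynomial factors.
  obtain ⟨g, hg1, hg2⟩ : ∃ g, gap L / c < g ∧ g < gap L :=
    exists_between (div_lt_self hgap hc)
  have hc0 : 0 < c := by linarith
  have hg0 : 0 < g := (div_pos hgap hc0).trans hg1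
  obtain ⟨C, hC, h⟩ := hL.exists_traceNorm_le hg2
  set a : ℝ := g * c / gap L - 1 with ha
  have ha0 : 0 < a := by
    rw [ha, sub_pos, lt_div_iff₀ hgap, one_mul]
    rwa [div_lt_iff₀ hc0] at hg1
  have hlim : Tendsto (fun n : ℕ => Fintype.card ι * C * (n : ℝ) ^ (-a)) atTop (𝓝 0) := by
    have := ((tendsto_rpow_neg_atTop ha0).comp tendsto_natCast_atTop_atTop).const_mul
      (Fintype.card ι * C : ℝ)
    simpa [Function.comp_def] using this
  have htop : Tendsto (fun n : ℕ => c * (Real.log n / gap L)) atTop atTop :=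
    ((Real.tendsto_log_atTop.comp tendsto_natCast_atTop_atTop).atTop_div_const hgap).const_mul_atTop
      hc0
  refine squeeze_zero' (Eventually.of_forall fun n => contraction_nonneg _) ?_ hlim
  filter_upwards [htop.eventually_ge_atTop 1, eventually_gt_atTop 0] with n hn hn0
  set t : ℝ := c * (Real.log n / gap L) with ht
  have hT := hL t (by linarith)
  refine contraction_le (by positivity) fun ρ hρ => ?_
  rw [hT.asymptotic_tensorPower, traceDist, ← LinearMap.sub_apply]
  have h1 := traceNorm_tensorPower_sub_le hT hT.asymptotic (by positivity)
    (fun σ hσ => h t hn hg0.le σ hσ) hρ.1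
  rw [hρ.2, Complex.one_re, mul_one] at h1
  have hn0' : (0 : ℝ) < n := by exact_mod_cast hn0
  have h2 : (n : ℝ) ^ (-a) = n * Real.exp (-(g * t)) := by
    rw [Real.rpow_def_of_pos hn0']
    conv_rhs => rw [← Real.exp_log hn0', ← Real.exp_add]
    congr 1
    rw [ha, ht]
    ring
  rw [h2]
  linarith

end Telescoping

/-! ### Distinguishing product states by Chebyshev's inequality. -/

section Chebyshev

variable {ι : Type*} [Fintype ι] [DecidableEq ι] {n : ℕ}

theorem sum_prod_eq_one {p : ι → ℝ} (hp : ∑ j, p j = 1) :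
    ∑ x : Fin n → ι, ∏ i, p (x i) = 1 := by
  have h := Finset.prod_univ_sum (fun _ : Fin n => (Finset.univ : Finset ι)) fun _ j => p j
  rw [Fintype.piFinset_univ] at h
  rw [← h]
  simp [hp]

/-- The variance of a sum of independent copies of a centred random variable. -/
theorem sum_prod_mul_sq_of_centred {p f : ι → ℝ} (hp : ∑ j, p j = 1) (hf : ∑ j, p j * f j = 0) :
    ∑ x : Fin n → ι, (∏ i, p (x i)) * (∑ i, f (x i)) ^ 2 = n * ∑ j, p j * f j ^ 2 := by
  have key (k l : Fin n) : ∑ x : Fin n → ι, (∏ i, p (x i)) * (f (x k) * f (x l))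
      = if k = l then ∑ j, p j * f j ^ 2 else 0 := by
    -- The summand becomes a product over the factors; for k ≠ l the sum over the k-th coordinate is
    -- the vanishing mean of f.
    let q (i : Fin n) (j : ι) : ℝ :=
      p j * ((if i = k then f j else 1) * (if i = l then f j else 1))
    have h1 (x : Fin n → ι) : (∏ i, p (x i)) * (f (x k) * f (x l)) = ∏ i, q i (x i) := by
      simp only [q, Finset.prod_mul_distrib]
      rw [Finset.prod_ite_eq' Finset.univ k fun i => f (x i),
        Finset.prod_ite_eq' Finset.univ l fun i => f (x i)]
      simp
    have h2 := Finset.prod_univ_sum (fun _ : Fin n => (Finset.univ : Finset ι)) q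
    rw [Fintype.piFinset_univ] at h2
    simp only [h1]
    rw [← h2]
    split_ifs with hkl
    · subst hkl
      rw [Finset.prod_eq_single k]
      · simp [q, sq]
      · intro i _ hi
        simp [q, hi, hp]
      · simp
    · refine Finset.prod_eq_zero (Finset.mem_univ k) ?_
      simpa [q, hkl] using hf
  calc ∑ x : Fin n → ι, (∏ i, p (x i)) * (∑ i, f (x i)) ^ 2
      = ∑ k, ∑ l, ∑ x : Fin n → ι, (∏ i, p (x i)) * (f (x k) * f (x l)) := by
        have e (x : Fin n → ι) : (∏ i, p (x i)) * (∑ i, f (x i)) ^ 2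
            = ∑ k, ∑ l, (∏ i, p (x i)) * (f (x k) * f (x l)) := by
          rw [sq, Finset.sum_mul_sum]
          simp only [Finset.mul_sum]
        simp only [e]
        rw [Finset.sum_comm]
        exact Finset.sum_congr rfl fun k _ => Finset.sum_comm
    _ = _ := by simp [key]

/-- After centring, the variance of one copy is at most its second moment, hence at most K². -/
theorem sum_prod_mul_sq_le {p h : ι → ℝ} {K m : ℝ} (hp0 : ∀ j, 0 ≤ p j) (hp : ∑ j, p j = 1)
    (hK : ∀ j, |h j| ≤ K) (hm : ∑ j, p j * h j = m) :
    ∑ x : Fin n → ι, (∏ i, p (x i)) * (∑ i, h (x i) - n * m) ^ 2 ≤ n * K ^ 2 := by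
  have h1 : ∑ j, p j * (h j - m) = 0 := by
    simp only [mul_sub, Finset.sum_sub_distrib, ← Finset.sum_mul, hp, hm]
    ring
  have h2 := sum_prod_mul_sq_of_centred (n := n) hp h1
  simp only [Finset.sum_sub_distrib, Finset.sum_const, Finset.card_univ, Fintype.card_fin,
    nsmul_eq_mul] at h2
  rw [h2]
  gcongr
  have h3 : ∑ j, p j * (h j - m) ^ 2 = ∑ j, p j * h j ^ 2 - m ^ 2 := by
    have e (j : ι) : p j * (h j - m) ^ 2 = p j * h j ^ 2 - 2 * m * (p j * h j) + m ^ 2 * p j := by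
      ring
    simp only [e, Finset.sum_add_distrib, Finset.sum_sub_distrib, ← Finset.mul_sum, hm, hp]
    ring
  have h4 : ∑ j, p j * h j ^ 2 ≤ ∑ j, p j * K ^ 2 := by
    refine Finset.sum_le_sum fun j _ => mul_le_mul_of_nonneg_left ?_ (hp0 j)
    exact sq_le_sq' (abs_le.mp (hK j)).1 (abs_le.mp (hK j)).2
  rw [← Finset.sum_mul, hp, one_mul] at h4
  nlinarith [sq_nonneg m]

/-- Chebyshev's inequality, as a lower bound on the signed difference of two product
distributions whose means of `h` are `m` and `0`. -/
theorem le_sum_sign_mul {p₁ p₀ h : ι → ℝ} {K m : ℝ} (hn : 0 < n) (hm : 0 < m)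
    (hp₁ : ∀ j, 0 ≤ p₁ j) (hs₁ : ∑ j, p₁ j = 1) (hp₀ : ∀ j, 0 ≤ p₀ j) (hs₀ : ∑ j, p₀ j = 1)
    (hK : ∀ j, |h j| ≤ K) (hm₁ : ∑ j, p₁ j * h j = m) (hm₀ : ∑ j, p₀ j * h j = 0) :
    2 - 16 * K ^ 2 / (n * m ^ 2) ≤ ∑ x : Fin n → ι,
      (if n * m / 2 ≤ ∑ i, h (x i) then (1 : ℝ) else -1) *
        (∏ i, p₁ (x i) - ∏ i, p₀ (x i)) := by
  have hn' : (0 : ℝ) < n := by exact_mod_cast hn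
  have hN : 0 < (n * m) ^ 2 := by positivity
  have v₁ := sum_prod_mul_sq_le (n := n) hp₁ hs₁ hK hm₁
  have v₀ := sum_prod_mul_sq_le (n := n) hp₀ hs₀ hK hm₀
  simp only [mul_zero, sub_zero] at v₀
  set s : (Fin n → ι) → ℝ := fun x => if n * m / 2 ≤ ∑ i, h (x i) then (1 : ℝ) else -1 with hs
  -- The threshold lies halfway between the means n m and 0. A wrong sign means a deviation of at
  -- least n m / 2, and the constant 8 turns its square into at least 2, the distance between the
  -- two signs.
  have b₁ (x : Fin n → ι) : 1 - 8 / (n * m) ^ 2 * (∑ i, h (x i) - n * m) ^ 2 ≤ s x := by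
    simp only [hs]
    split_ifs with hx
    · have : 0 ≤ 8 / (n * m) ^ 2 * (∑ i, h (x i) - n * m) ^ 2 := by positivity
      linarith
    · push Not at hx
      have h1 : 2 ≤ 8 / (n * m) ^ 2 * (∑ i, h (x i) - n * m) ^ 2 := by
        rw [div_mul_eq_mul_div, le_div_iff₀ hN]
        nlinarith [mul_pos hn' hm]
      linarith
  have b₀ (x : Fin n → ι) : s x ≤ -1 + 8 / (n * m) ^ 2 * (∑ i, h (x i)) ^ 2 := by
    simp only [hs]
    split_ifs with hx
    · have h1 : 2 ≤ 8 / (n * m) ^ 2 * (∑ i, h (x i)) ^ 2 := by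
        rw [div_mul_eq_mul_div, le_div_iff₀ hN]
        nlinarith [mul_pos hn' hm]
      linarith
    · have : 0 ≤ 8 / (n * m) ^ 2 * (∑ i, h (x i)) ^ 2 := by positivity
      linarith
  have e₁ : 1 - 8 / (n * m) ^ 2 * (n * K ^ 2) ≤ ∑ x, s x * ∏ i, p₁ (x i) := by
    calc 1 - 8 / (n * m) ^ 2 * (n * K ^ 2)
        ≤ 1 - 8 / (n * m) ^ 2 *
          ∑ x : Fin n → ι, (∏ i, p₁ (x i)) * (∑ i, h (x i) - n * m) ^ 2 := by gcongr
      _ = ∑ x : Fin n → ι, (1 - 8 / (n * m) ^ 2 * (∑ i, h (x i) - n * m) ^ 2) *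
          ∏ i, p₁ (x i) := by
        simp only [sub_mul, one_mul, Finset.sum_sub_distrib, sum_prod_eq_one hs₁, Finset.mul_sum]
        congr 1
        exact Finset.sum_congr rfl fun x _ => by ring
      _ ≤ _ := Finset.sum_le_sum fun x _ =>
        mul_le_mul_of_nonneg_right (b₁ x) (Finset.prod_nonneg fun i _ => hp₁ _)
  have e₀ : ∑ x, s x * ∏ i, p₀ (x i) ≤ -1 + 8 / (n * m) ^ 2 * (n * K ^ 2) := by
    calc ∑ x, s x * ∏ i, p₀ (x i)
        ≤ ∑ x : Fin n → ι, (-1 + 8 / (n * m) ^ 2 * (∑ i, h (x i)) ^ 2) *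
          ∏ i, p₀ (x i) := Finset.sum_le_sum fun x _ =>
        mul_le_mul_of_nonneg_right (b₀ x) (Finset.prod_nonneg fun i _ => hp₀ _)
      _ = -1 + 8 / (n * m) ^ 2 * ∑ x : Fin n → ι, (∏ i, p₀ (x i)) * (∑ i, h (x i)) ^ 2 := by
        simp only [add_mul, Finset.sum_add_distrib, ← Finset.mul_sum, sum_prod_eq_one hs₀,
          mul_one, mul_assoc]
        congr 2
        exact Finset.sum_congr rfl fun x _ => by ring
      _ ≤ _ := by gcongr
  have e₂ : 8 / (n * m) ^ 2 * (n * K ^ 2) = 8 * K ^ 2 / (n * m ^ 2) := by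
    field_simp
  simp only [mul_sub, Finset.sum_sub_distrib]
  have e₃ : 16 * K ^ 2 / (n * m ^ 2) = 2 * (8 * K ^ 2 / (n * m ^ 2)) := by ring
  rw [e₂] at e₁ e₀
  linarith

/-- Two product states are nearly perfectly distinguishable if the mean of an observable differs
by much more than `1 / √n`. -/
theorem le_traceDist_pureTensor {H : Matrix ι ι ℂ} (hH : H.IsHermitian) {K m : ℝ} (hn : 0 < n)
    (hm : 0 < m) (hK : ∀ j, |hH.eigenvalues j| ≤ K) {σ₁ σ₀ : Matrix ι ι ℂ} (h₁ : σ₁ ∈ states ι)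
    (h₀ : σ₀ ∈ states ι) (hm₁ : (H * σ₁).trace = m) (hm₀ : (H * σ₀).trace = 0) :
    1 - 8 * K ^ 2 / (n * m ^ 2) ≤
      traceDist (pureTensor fun _ : Fin n => σ₁) (pureTensor fun _ : Fin n => σ₀) := by
  set U : Matrix ι ι ℂ := (hH.eigenvectorUnitary).1
  have hU : U * Uᴴ = 1 := Unitary.coe_mul_star_self _
  -- Measuring each factor in the eigenbasis of H gives product distributions of outcomes.
  let W : Matrix (Fin n → ι) (Fin n → ι) ℂ := pureTensor fun _ => U
  have hW : W * Wᴴ = 1 := by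
    simp only [W, pureTensor_conjTranspose, pureTensor_mul, hU, pureTensor_one]
  let p (σ : Matrix ι ι ℂ) (j : ι) : ℝ := ((Uᴴ * σ * U) j j).re
  have hp0 {σ : Matrix ι ι ℂ} (hσ : σ ∈ states ι) (j : ι) : 0 ≤ p σ j :=
    PosSemidef.re_diag_nonneg (hσ.1.conjTranspose_mul_mul_same U) j
  have hpc {σ : Matrix ι ι ℂ} (hσ : σ ∈ states ι) (j : ι) : (Uᴴ * σ * U) j j = p σ j := by
    refine Complex.ext rfl ?_
    simpa using (Complex.le_def.mp (hσ.1.conjTranspose_mul_mul_same U).diag_nonneg).2.symm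
  have hp1 {σ : Matrix ι ι ℂ} (hσ : σ ∈ states ι) : ∑ j, p σ j = 1 := by
    have h := trace_unitary_conj hU σ
    rw [hσ.2] at h
    have h2 := congrArg Complex.re h
    simpa [Matrix.trace] using h2
  have hpm (σ : Matrix ι ι ℂ) : ∑ j, p σ j * hH.eigenvalues j = (H * σ).trace.re := by
    have hD := eigenvectorUnitary_conj hH
    change Uᴴ * H * U = _ at hD
    rw [← trace_unitary_conj hU (H * σ),
      show Uᴴ * (H * σ) * U = (Uᴴ * H * U) * (Uᴴ * σ * U) by
        simp only [mul_assoc]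
        rw [← mul_assoc U Uᴴ, hU, one_mul], hD]
    simp [Matrix.trace, Matrix.diagonal_mul, p, mul_comm]
  have hdiag {σ : Matrix ι ι ℂ} (hσ : σ ∈ states ι) (x : Fin n → ι) :
      ((Wᴴ * (pureTensor fun _ : Fin n => σ) * W) x x).re = ∏ i, p σ (x i) := by
    simp only [W, pureTensor_conjTranspose, pureTensor_mul]
    simp only [pureTensor, Matrix.of_apply, hpc hσ]
    rw [← Complex.ofReal_prod, Complex.ofReal_re]
  have hc := le_sum_sign_mul (n := n) hn hm (hp0 h₁) (hp1 h₁) (hp0 h₀) (hp1 h₀) hK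
    (by rw [hpm, hm₁, Complex.ofReal_re]) (by rw [hpm, hm₀, Complex.zero_re])
  have hherm : ((pureTensor fun _ : Fin n => σ₁) - pureTensor fun _ => σ₀).IsHermitian :=
    (posSemidef_pureTensor fun _ => h₁.1).isHermitian.sub
      (posSemidef_pureTensor fun _ => h₀.1).isHermitian
  have ht := sum_sign_diag_le_traceNorm hW hherm
    (fun x => if n * m / 2 ≤ ∑ i, hH.eigenvalues (x i) then (1 : ℝ) else -1)
    (fun x => by split_ifs <;> simp)
  simp only [mul_sub, sub_mul, Matrix.sub_apply, Complex.sub_re, hdiag h₁, hdiag h₀] at ht hc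
  rw [traceDist]
  have e : 16 * K ^ 2 / (n * m ^ 2) = 2 * (8 * K ^ 2 / (n * m ^ 2)) := by ring
  linarith

end Chebyshev

/-! ### Lower bound from a slowest decaying left eigenvector. -/

section LowerBound

variable {ι : Type*} [Fintype ι] [DecidableEq ι]

/-- In finite dimension z - L is not surjective, so some nonzero functional vanishes on its range.
-/
theorem exists_left_eigenvector {L : SuperOp ι} {z : ℂ} (hz : z ∈ spectrum ℂ L) :
    ∃ f : Matrix ι ι ℂ →ₗ[ℂ] ℂ, f ≠ 0 ∧ ∀ X, f (L X) = z * f X := by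
  have h1 : LinearMap.range (algebraMap ℂ (SuperOp ι) z - L) < ⊤ := by
    rw [lt_top_iff_ne_top, Ne, LinearMap.range_eq_top]
    intro hs
    refine spectrum.mem_iff.mp hz ((Module.End.isUnit_iff _).mpr ⟨?_, hs⟩)
    exact LinearMap.injective_iff_surjective.mpr hs
  obtain ⟨f, hf0, hf⟩ := Submodule.exists_le_ker_of_lt_top _ h1
  refine ⟨f, hf0, fun X => ?_⟩
  have h2 : f ((algebraMap ℂ (SuperOp ι) z - L) X) = 0 := hf ⟨X, rfl⟩
  rw [LinearMap.sub_apply, Module.algebraMap_end_apply, map_sub, map_smul, sub_eq_zero] at h2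
  simpa using h2.symm

/-- The states span all matrices. -/
theorem exists_state_apply_ne_zero {f : Matrix ι ι ℂ →ₗ[ℂ] ℂ} (hf : f ≠ 0) :
    ∃ ρ ∈ states ι, f ρ ≠ 0 := by
  by_contra! h
  have hpos {A : Matrix ι ι ℂ} (hA : A.PosSemidef) : f A = 0 := by
    rcases eq_or_ne A.trace 0 with h0 | h0
    · rw [hA.trace_eq_zero_iff.mp h0, map_zero]
    · have hinv : (0 : ℂ) ≤ (A.trace)⁻¹ := inv_nonneg.mpr hA.trace_nonneg
      have h1 := h (A.trace⁻¹ • A) ⟨hA.smul hinv, by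
        rw [Matrix.trace_smul, smul_eq_mul, inv_mul_cancel₀ h0]⟩
      rw [map_smul] at h1
      exact (smul_eq_zero.mp h1).resolve_left (inv_ne_zero h0)
  refine hf (LinearMap.ext fun X => ?_)
  obtain ⟨A, B, C, D, hA, hB, hC, hD, rfl⟩ := exists_posSemidef_combination X
  simp [hpos hA, hpos hB, hpos hC, hpos hD]

theorem exists_trace_mul_eq (f : Matrix ι ι ℂ →ₗ[ℂ] ℂ) :
    ∃ Y : Matrix ι ι ℂ, ∀ X, f X = (Y * X).trace := by
  let Y : Matrix ι ι ℂ := Matrix.of fun b a => f (Matrix.single a b 1)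
  refine ⟨Y, fun X => ?_⟩
  have h : f = Matrix.traceLinearMap ι ℂ ℂ ∘ₗ LinearMap.mulLeft ℂ Y :=
    linearMap_ext_single fun a b => by simp [Y, Matrix.trace_mul_single]
  exact LinearMap.congr_fun h X

/-- A functional on matrices, rotated by a phase, is the mean of an observable whose size does not
depend on the phase. -/
theorem exists_observable (f : Matrix ι ι ℂ →ₗ[ℂ] ℂ) :
    ∃ K : ℝ, ∀ ω : ℂ, ‖ω‖ = 1 → ∃ (H : Matrix ι ι ℂ) (hH : H.IsHermitian),
      (∀ j, |hH.eigenvalues j| ≤ K) ∧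
      ∀ X : Matrix ι ι ℂ, X.IsHermitian → (H * X).trace = ((ω * f X).re : ℂ) := by
  obtain ⟨Y, hY⟩ := exists_trace_mul_eq f
  refine ⟨∑ a, ∑ b, (‖Y a b‖ + ‖Y b a‖), fun ω hω => ?_⟩
  -- H is the Hermitian part of ωY. The bound K must not depend on ω, because the phase used later
  -- varies with t and hence with n.
  let H : Matrix ι ι ℂ := (1 / 2 : ℂ) • (ω • Y + star ω • Yᴴ)
  have hH : H.IsHermitian := by
    simp only [H, Matrix.IsHermitian, Matrix.conjTranspose_smul, Matrix.conjTranspose_add,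
      Matrix.conjTranspose_conjTranspose, star_star]
    rw [add_comm]
    simp
  refine ⟨H, hH, fun j => (abs_eigenvalues_le hH j).trans ?_, fun X hX => ?_⟩
  · refine Finset.sum_le_sum fun a _ => Finset.sum_le_sum fun b _ => ?_
    simp only [H, Matrix.smul_apply, Matrix.add_apply, Matrix.conjTranspose_apply, norm_smul]
    have h1 : ‖ω • Y a b + star ω • star (Y b a)‖ ≤ ‖Y a b‖ + ‖Y b a‖ := by
      refine (norm_add_le _ _).trans (le_of_eq ?_)
      rw [norm_smul, norm_smul, norm_star, norm_star, hω, one_mul, one_mul]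
    have h2 : ‖(1 / 2 : ℂ)‖ ≤ 1 := by norm_num
    exact (mul_le_of_le_one_left (norm_nonneg _) h2).trans h1
  · have h1 : (Yᴴ * X).trace = star (f X) := by
      rw [hY, ← Matrix.trace_conjTranspose, Matrix.conjTranspose_mul, hX, Matrix.trace_mul_comm]
    simp only [H, Matrix.smul_mul, Matrix.add_mul, Matrix.trace_smul, Matrix.trace_add, h1, ← hY,
      smul_eq_mul]
    rw [Complex.re_eq_add_conj, map_mul, Complex.star_def]
    ring

/-- Along the powers of T_t the functional is multiplied by e^{ktz} → 0, and P is a limit of such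
powers. -/
theorem IsLiouvillian.left_eigen_asymptotic {L : SuperOp ι} (hL : IsLiouvillian L) {z : ℂ}
    (hz : z.re < 0) {f : Matrix ι ι ℂ →ₗ[ℂ] ℂ} (hf : ∀ X, f (L X) = z * f X) {t : ℝ} (ht : 0 < t)
    (X : Matrix ι ι ℂ) : f (asymptotic (evolution L t) X) = 0 := by
  have hT := hL t ht.le
  obtain ⟨F, _, hF, h⟩ := hT.powerBounded.exists_tendsto_peripheralProj
  rw [hT.powerBounded.asymptotic_eq, Module.End.mul_apply, evolution_left_eigen hf]
  have hfc : Continuous f := LinearMap.continuous_of_finiteDimensional f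
  have h1 := (hfc.tendsto _).comp (h X)
  have h2 : Tendsto (fun k : ℕ => f ((evolution L t ^ k) X)) F (𝓝 0) := by
    have e (k : ℕ) : f ((evolution L t ^ k) X) = Complex.exp (t * z) ^ k * f X := by
      rw [← evolution_natCast_mul, evolution_left_eigen hf, ← Complex.exp_nat_mul]
      push_cast
      rw [mul_assoc]
    simp only [e]
    have h3 : ‖Complex.exp (t * z)‖ < 1 := by
      rw [Complex.norm_exp, Real.exp_lt_one_iff, Complex.re_ofReal_mul]
      exact mul_neg_of_pos_of_neg ht hz
    have := (tendsto_pow_atTop_nhds_zero_of_norm_lt_one h3).mul_const (f X)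
    rw [zero_mul] at this
    exact this.mono_left hF
  rw [tendsto_nhds_unique h1 h2, mul_zero]

theorem IsLiouvillian.tendsto_contraction_one {L : SuperOp ι} (hL : IsLiouvillian L)
    (hneg : ∃ z ∈ spectrum ℂ L, z.re < 0) {c : ℝ} (hc0 : 0 < c) (hc : c < 1) :
    Tendsto (fun n : ℕ =>
      contraction (tensorPower n (evolution L (c * (Real.log n / (2 * gap L)))))) atTop (𝓝 1) := by
  obtain ⟨z, hz, hre, hgap⟩ := exists_re_eq_neg_gap hneg
  obtain ⟨f, hf0, hf⟩ := exists_left_eigenvector hz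
  obtain ⟨ρ, hρ, hfρ⟩ := exists_state_apply_ne_zero hf0
  obtain ⟨K, hK⟩ := exists_observable f
  have ha : 0 < ‖f ρ‖ := norm_pos_iff.mpr hfρ
  have hlim : Tendsto (fun n : ℕ => 1 - 8 * K ^ 2 / ‖f ρ‖ ^ 2 * (n : ℝ) ^ (-(1 - c)))
      atTop (𝓝 1) := by
    have := (((tendsto_rpow_neg_atTop (sub_pos.mpr hc)).comp
      tendsto_natCast_atTop_atTop).const_mul (8 * K ^ 2 / ‖f ρ‖ ^ 2)).const_sub 1
    simpa [Function.comp_def] using this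
  refine tendsto_of_tendsto_of_tendsto_of_le_of_le' hlim tendsto_const_nhds ?_ ?_
  -- n > 1 gives t > 0, which the vanishing of f on asymptotic states requires.
  · filter_upwards [eventually_gt_atTop 1] with n hn
    have hn1 : (1 : ℝ) < n := by exact_mod_cast hn
    have hn0 : (0 : ℝ) < n := by linarith
    have hlog : 0 < Real.log n := Real.log_pos hn1
    set t : ℝ := c * (Real.log n / (2 * gap L)) with ht
    have ht0 : 0 < t := by positivity
    have hT := hL t ht0.le
    set m : ℝ := ‖f (evolution L t ρ)‖ with hm
    have hm' : m = Real.exp (-(gap L * t)) * ‖f ρ‖ := by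
      rw [hm, evolution_left_eigen hf, norm_mul, Complex.norm_exp, Complex.re_ofReal_mul, hre]
      congr 2
      ring
    have hm0 : 0 < m := by rw [hm']; positivity
    have hmne : (m : ℂ) ≠ 0 := by exact_mod_cast hm0.ne'
    -- This phase rotates f(T_t ρ) onto its modulus m.
    obtain ⟨H, hH, hHK, hHf⟩ := hK (star (f (evolution L t ρ)) / m) (by
      rw [norm_div, norm_star, Complex.norm_real, ← hm, Real.norm_of_nonneg hm0.le,
        div_self hm0.ne'])
    have h1 := hT.apply_mem_states hρ
    have h0 := hT.asymptotic.apply_mem_states hρ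
    have hm1 : (H * evolution L t ρ).trace = m := by
      rw [hHf _ h1.1.isHermitian, div_mul_eq_mul_div, Complex.star_def,
        Complex.conj_mul', ← hm, sq, mul_div_assoc, div_self hmne, mul_one, Complex.ofReal_re]
    have hm2 : (H * asymptotic (evolution L t) ρ).trace = 0 := by
      rw [hHf _ h0.1.isHermitian, hL.left_eigen_asymptotic (by linarith) hf ht0]
      simp
    have hb := le_traceDist_pureTensor (n := n) hH (by omega) hm0 hHK h1 h0 hm1 hm2
    have hd := (hT.tensorPower (n := n)).traceDist_le_contraction
      (pureTensor_mem_states fun _ : Fin n => hρ)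
    rw [hT.asymptotic_tensorPower, tensorPower_pureTensor, tensorPower_pureTensor] at hd
    refine le_trans (le_of_eq ?_) (hb.trans hd)
    -- At t = c log n / (2 gap), m² equals |f ρ|² n^{-c}, so n m² diverges exactly because c < 1.
    have he : (n : ℝ) * m ^ 2 = ‖f ρ‖ ^ 2 * (n : ℝ) ^ (1 - c) := by
      rw [hm', Real.rpow_def_of_pos hn0, mul_pow, ← Real.exp_nat_mul]
      conv_lhs => rw [← Real.exp_log hn0]
      rw [← mul_assoc, ← Real.exp_add, mul_comm]
      congr 2
      rw [ht]
      field_simp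
      push_cast
      ring
    rw [he, Real.rpow_neg hn0.le]
    field_simp
  · filter_upwards [eventually_ge_atTop 1] with n hn
    have : 0 ≤ c * (Real.log n / (2 * gap L)) := by
      have : 0 ≤ Real.log n := Real.log_natCast_nonneg n
      positivity
    exact (hL _ this).tensorPower.contraction_le_one

end LowerBound

/-! ### Assembly of the pre-cutoff. -/

section Main

variable {ι : Type*} [Fintype ι] [DecidableEq ι]

theorem IsLiouvillian.preCutoff_tensorPower {L : SuperOp ι} (hL : IsLiouvillian L)
    (hneg : ∃ z ∈ spectrum ℂ L, z.re < 0) :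
    PreCutoff (fun n t => tensorPower n (evolution L t))
      (fun n => Real.log n)
      (fun n => Real.log n / (2 * gap L))
      (fun n => Real.log n / gap L) := by
  obtain ⟨-, -, -, hgap⟩ := exists_re_eq_neg_gap hneg
  have hΘ (a : ℝ) (ha : a ≠ 0) :
      (fun n : ℕ => Real.log n / a) =Θ[atTop] fun n : ℕ => Real.log n := by
    simp only [div_eq_inv_mul]
    exact (isTheta_const_mul_left (inv_ne_zero ha)).mpr (isTheta_refl _ _)
  exact
    { semigroup := hL.isChannelSemigroup_tensorPower
      order₁ := hΘ _ (by positivity)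
      order₂ := hΘ _ hgap.ne'
      before := fun _ hc0 hc => hL.tendsto_contraction_one hneg hc0 hc
      after := fun _ hc => hL.tendsto_contraction_zero hgap hc }

end Main

end QuantumCutoff

end

open QuantumCutoff in
theorem theorem7 (d : ℕ) :
    (∀ L : SuperOp (Fin d), IsLiouvillian L → (∃ z ∈ spectrum ℂ L, z.re < 0) →
      PreCutoff (fun n t => tensorPower n (evolution L t))
        (fun n => Real.log n)
        (fun n => Real.log n / (2 * gap L))
        (fun n => Real.log n / gap L)) ∧
    (∀ T : SuperOp (Fin d), IsChannel T → ∀ d' : ℕ,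
      contraction (tensorId T (Fin d')) ≤ 4 * d * contraction T) := by
  refine ⟨fun L hL hneg => hL.preCutoff_tensorPower hneg, fun T hT d' => ?_⟩
  have h := hT.contraction_tensorId_le (κ := Fin d')
  rw [Fintype.card_fin] at h
  have h0 : 0 ≤ d * contraction T := mul_nonneg d.cast_nonneg (contraction_nonneg T)
  linarith
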